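/- Let $\Bbbk$ be a field of characteristic zero, let $n=2m+1$ be an odd integer, and let $S=\Bbbk[x_1,\ldots,x_n]$ with the standard grading. For a homogeneous ideal $I\subset S$ with $A=S/I$ artinian, we say that $A$ *fails the WLP in degree $i$* if for every linear form $\ell\in A_1$ the multiplication map $\times\ell\colon A_i\to A_{i+1}$ is neither injective nor surjective. 1. Let $d\ge 5$ and $n\ge 5$, and let $I=(x_1^d,\ldots,x_n^d,\;x_1^{\lceil d/2\rceil}x_2^{\lfloor d/2\rfloor})$. Then $S/I$ fails the WLP in degree $\left\lfloor \frac{n(d-1)}{2}\right\rfloor-1$. 2. Let $n\ge 5$, and let $I=(x_1^4,\ldots,x_n^4,\;x_1x_2x_3x_4)$. Then $S/I$ fails the WLP in degree $3m$. 3. Let $n\ge 3$, and let $I=(x_1^3,\ldots,x_n^3,\;x_1x_2x_3)$. Then $S/I$ fails the WLP in degree $2m$. -/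

import Mathlib

/-- The degree-`i` graded piece `A_i` of `A = K[x_1, …, x_n] / I` (for a homogeneous ideal `I`): the
image in the quotient of the homogeneous polynomials of degree `i`. -/
noncomputable def gradedPiece {K : Type*} [Field K] {n : ℕ} (I : Ideal (MvPolynomial (Fin n) K)) (i : ℕ) :
    Submodule K (MvPolynomial (Fin n) K ⧸ I) :=
  (MvPolynomial.homogeneousSubmodule (Fin n) K i).map (Ideal.Quotient.mkₐ K I).toLinearMap

theorem mul_mem_gradedPiece {K : Type*} [Field K] {n : ℕ} {I : Ideal (MvPolynomial (Fin n) K)}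
    {i : ℕ} {l a : MvPolynomial (Fin n) K ⧸ I} (hl : l ∈ gradedPiece I 1)
    (ha : a ∈ gradedPiece I i) : l * a ∈ gradedPiece I (i + 1) := by
  obtain ⟨p, hp, rfl⟩ := hl
  obtain ⟨q, hq, rfl⟩ := ha
  refine ⟨p * q, ?_, by simp⟩
  have h := MvPolynomial.IsHomogeneous.mul (show p.IsHomogeneous 1 from hp)
    (show q.IsHomogeneous i from hq)
  rw [add_comm] at h
  exact h

/-- Multiplication by a linear form `l ∈ A_1`, as a `K`-linear map `A_i → A_{i+1}`. -/
noncomputable def mulLinearForm {K : Type*} [Field K] {n : ℕ} (I : Ideal (MvPolynomial (Fin n) K))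
    (l : gradedPiece I 1) (i : ℕ) : gradedPiece I i →ₗ[K] gradedPiece I (i + 1) :=
  (LinearMap.mulLeft K (l : MvPolynomial (Fin n) K ⧸ I)).restrict
    fun _ ha => mul_mem_gradedPiece l.2 ha

/-- `A = K[x_1, …, x_n] / I` fails the weak Lefschetz property in degree `i`: there is no linear
form `l ∈ A_1` for which multiplication `A_i → A_{i+1}` has maximal rank, that is, is injective
or surjective. -/
def FailsWLPInDegree {K : Type*} [Field K] {n : ℕ} (I : Ideal (MvPolynomial (Fin n) K))
    (i : ℕ) : Prop :=
  ∀ l : gradedPiece I 1, ¬ (Function.Injective (mulLinearForm I l i) ∨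
    Function.Surjective (mulLinearForm I l i))

/-- The ideal `(x_1^d, …, x_n^d, u)` of `K[x_1, …, x_n]`. -/
noncomputable def powersAnd {K : Type*} [Field K] {n : ℕ} (d : ℕ) (u : MvPolynomial (Fin n) K) :
    Ideal (MvPolynomial (Fin n) K) :=
  Ideal.span (Set.range (fun i : Fin n => (MvPolynomial.X i : MvPolynomial (Fin n) K) ^ d) ∪ {u})

/-! Maximal rank is an open condition on ℓ: if ×ℓ is injective or surjective, it stays so at all but
finitely many points of the line ℓ + t(x_1 + ⋯ + x_n). So it suffices to obstruct both properties
for ℓ = ∑ c_j x_j with every c_j nonzero (`failsWLPInDegree_of_obstructions`). The ideal is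
monomial, so rescaling the variables turns such an ℓ into the sum of the variables; the weights c^a
and c^(-a) below are this rescaling.

Injectivity fails by a dimension count on a subspace. Call the variables of the extra generator the
core and the other k variables the tail. Multiplication by the sum of the variables preserves the
polynomials symmetric in the core (no symmetry is imposed when the generator is x_1^(e+1) x_2^e).
The dimension of that part of the quotient in degree i is a sum, over classes of core exponents, of
coefficients of (1 + t + ⋯ + t^(d-1))^k. These coefficients are symmetric and unimodal, strictly so
for k ≥ 2 (`boxCount_le`, `boxCount_lt`). Taking differences telescopes the sum, and the dimension
is seen to drop from degree i to i + 1, which forces a kernel (`exists_mul_mem_of_boxCount_lt`).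

Surjectivity fails by Macaulay duality. A nonzero form F of degree i + 1, annihilated by ∑ ∂/∂x_j
and with no monomial in the ideal, gives a functional that is nonzero on A_(i+1) and vanishes on
ℓA_i (`IsDualSocleForm.exists_functional`). Such F are built from differences of variables: a form
adapted to the generator in the first few variables, times (x_i - x_j)^(d-1) for each further pair
of variables. -/

open MvPolynomial

/-! ### Linear forms and genericity of maximal rank -/

/-- The linear form `∑ c_i x_i`. -/
noncomputable def linearForm {K : Type*} [Field K] {n : ℕ} (c : Fin n → K) :
    MvPolynomial (Fin n) K :=
  ∑ i, C (c i) * X i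

theorem linearForm_isHomogeneous {K : Type*} [Field K] {n : ℕ} (c : Fin n → K) :
    (linearForm c).IsHomogeneous 1 := by
  refine IsHomogeneous.sum _ _ _ fun i _ => ?_
  simpa using (isHomogeneous_C (Fin n) (c i)).mul (isHomogeneous_X K i)

theorem exists_eq_linearForm {K : Type*} [Field K] {n : ℕ} {p : MvPolynomial (Fin n) K}
    (hp : p.IsHomogeneous 1) : ∃ c : Fin n → K, p = linearForm c := by
  have h : p ∈ homogeneousSubmodule (Fin n) K 1 := hp
  rw [homogeneousSubmodule_one_eq_span_X, Submodule.mem_span_range_iff_exists_fun] at h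
  obtain ⟨c, rfl⟩ := h
  exact ⟨c, by simp [linearForm, smul_eq_C_mul]⟩

theorem linearForm_add_smul {K : Type*} [Field K] {n : ℕ} (c e : Fin n → K) (t : K) :
    linearForm (c + t • e) = linearForm c + t • linearForm e := by
  simp [linearForm, smul_eq_C_mul, add_mul, Finset.sum_add_distrib, Finset.mul_sum, mul_assoc]

instance gradedPiece_finite {K : Type*} [Field K] {n : ℕ} (I : Ideal (MvPolynomial (Fin n) K))
    (i : ℕ) : Module.Finite K (gradedPiece I i) := by
  rw [Module.Finite.iff_fg]
  exact (homogeneousSubmodule_fg (Fin n) K i).map _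

/-- Apart from finitely many values of `t`, the operator `1 + t E` is injective. -/
theorem finite_not_injective_one_add_smul {K V : Type*} [Field K] [AddCommGroup V] [Module K V]
    [FiniteDimensional K V] (E : Module.End K V) :
    {t : K | ¬ Function.Injective (LinearMap.id + t • E : V →ₗ[K] V)}.Finite := by
  -- A nonzero v with (1 + tE)v = 0 forces t ≠ 0 and makes -t⁻¹ an eigenvalue of E, of which there
  -- are finitely many.
  have h := (Module.End.finite_hasEigenvalue E).preimage
    (f := fun t : K => -t⁻¹) (s := E.HasEigenvalue) (by
      intro a _ b _ hab
      simpa using hab)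
  refine h.subset fun t ht => ?_
  have ht' : ¬ Function.Injective (LinearMap.id + t • E : V →ₗ[K] V) := ht
  rw [injective_iff_map_eq_zero] at ht'
  push Not at ht'
  obtain ⟨v, hv, hv0⟩ := ht'
  have hv' : v + t • E v = 0 := by simpa using hv
  have ht0 : t ≠ 0 := by
    rintro rfl
    simp at hv'
    exact hv0 hv'
  refine Module.End.hasEigenvalue_of_hasEigenvector (x := v) ⟨?_, hv0⟩
  rw [Module.End.mem_eigenspace_iff]
  have : t⁻¹ • (v + t • E v) = 0 := by rw [hv', smul_zero]
  rw [smul_add, smul_smul, inv_mul_cancel₀ ht0, one_smul] at this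
  rw [neg_smul]
  exact eq_neg_of_add_eq_zero_right this

/-- If `M₀` is injective, so is `M₀ + t M₁` for all but finitely many `t`. -/
theorem finite_not_injective_add_smul {K V W : Type*} [Field K] [AddCommGroup V] [Module K V]
    [FiniteDimensional K V] [AddCommGroup W] [Module K W] (M₀ M₁ : V →ₗ[K] W)
    (h : Function.Injective M₀) : {t : K | ¬ Function.Injective (M₀ + t • M₁)}.Finite := by
  obtain ⟨N, hN⟩ := M₀.exists_leftInverse_of_injective (LinearMap.ker_eq_bot.mpr h)
  refine (finite_not_injective_one_add_smul (N ∘ₗ M₁)).subset fun t ht => ?_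
  refine fun hinj => ht ?_
  have : (LinearMap.id + t • (N ∘ₗ M₁) : V →ₗ[K] V) = N ∘ₗ (M₀ + t • M₁) := by
    rw [← hN]; ext; simp
  rw [this, LinearMap.coe_comp] at hinj
  exact hinj.of_comp

/-- If `M₀` is surjective, so is `M₀ + t M₁` for all but finitely many `t`. -/
theorem finite_not_surjective_add_smul {K V W : Type*} [Field K] [AddCommGroup V] [Module K V]
    [AddCommGroup W] [Module K W] [FiniteDimensional K W] (M₀ M₁ : V →ₗ[K] W)
    (h : Function.Surjective M₀) : {t : K | ¬ Function.Surjective (M₀ + t • M₁)}.Finite := by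
  obtain ⟨N, hN⟩ := M₀.exists_rightInverse_of_surjective (LinearMap.range_eq_top.mpr h)
  refine (finite_not_injective_one_add_smul (M₁ ∘ₗ N)).subset fun t ht => ?_
  refine fun hinj => ht ?_
  have : (LinearMap.id + t • (M₁ ∘ₗ N) : W →ₗ[K] W) = (M₀ + t • M₁) ∘ₗ N := by
    rw [← hN]; ext; simp
  rw [this] at hinj
  have hs := LinearMap.injective_iff_surjective.mp hinj
  rw [LinearMap.coe_comp] at hs
  exact hs.of_comp

/-- The class of a linear form in the degree-one piece. -/
noncomputable def linearClass {K : Type*} [Field K] {n : ℕ} (I : Ideal (MvPolynomial (Fin n) K))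
    (c : Fin n → K) : gradedPiece I 1 :=
  ⟨Ideal.Quotient.mkₐ K I (linearForm c), linearForm c, linearForm_isHomogeneous c, rfl⟩

theorem exists_eq_linearClass {K : Type*} [Field K] {n : ℕ}
    {I : Ideal (MvPolynomial (Fin n) K)} (l : gradedPiece I 1) :
    ∃ c, l = linearClass I c := by
  obtain ⟨l, p, hp, rfl⟩ := l
  obtain ⟨c, rfl⟩ := exists_eq_linearForm hp
  exact ⟨c, rfl⟩

theorem mulLinearForm_add_smul {K : Type*} [Field K] {n : ℕ}
    (I : Ideal (MvPolynomial (Fin n) K)) (c e : Fin n → K) (t : K) (i : ℕ) :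
    mulLinearForm I (linearClass I (c + t • e)) i =
      mulLinearForm I (linearClass I c) i + t • mulLinearForm I (linearClass I e) i := by
  ext a
  simp only [mulLinearForm, linearClass, linearForm_add_smul, map_add, map_smul,
    LinearMap.coe_restrict_apply, LinearMap.mulLeft_apply, LinearMap.add_apply,
    LinearMap.smul_apply, Submodule.coe_add, Submodule.coe_smul, add_mul, smul_mul_assoc]

/-- A finite set of values of `t` can be avoided while making all coefficients of
`c + t (1, …, 1)` nonzero. -/
theorem exists_add_smul_one_ne_zero {K : Type*} [Field K] [CharZero K] {n : ℕ} (c : Fin n → K)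
    {B : Set K} (hB : B.Finite) : ∃ t ∉ B, ∀ i, (c + t • (1 : Fin n → K)) i ≠ 0 := by
  have hfin : (B ∪ Set.range fun i => - c i).Finite := hB.union (Set.finite_range _)
  obtain ⟨t, ht⟩ := hfin.infinite_compl.nonempty
  simp only [Set.mem_compl_iff, Set.mem_union, not_or, Set.mem_range, not_exists] at ht
  refine ⟨t, ht.1, fun i hi => ht.2 i ?_⟩
  simp at hi
  linear_combination -hi

/-- To fail the WLP it is enough to have obstructions to injectivity and surjectivity for linear
forms all of whose coefficients are nonzero. -/
theorem failsWLPInDegree_of_obstructions {K : Type*} [Field K] [CharZero K] {n : ℕ}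
    {I : Ideal (MvPolynomial (Fin n) K)} {i : ℕ}
    (hker : ∀ c : Fin n → K, (∀ j, c j ≠ 0) → ∃ p : MvPolynomial (Fin n) K,
      p.IsHomogeneous i ∧ p ∉ I ∧ linearForm c * p ∈ I)
    (hcoker : ∀ c : Fin n → K, (∀ j, c j ≠ 0) → ∃ φ : MvPolynomial (Fin n) K →ₗ[K] K,
      (∀ p ∈ I, φ p = 0) ∧ (∀ p, φ (linearForm c * p) = 0) ∧
        ∃ p : MvPolynomial (Fin n) K, p.IsHomogeneous (i + 1) ∧ φ p ≠ 0) :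
    FailsWLPInDegree I i := by
  intro l
  obtain ⟨c, rfl⟩ := exists_eq_linearClass l
  rintro (h | h)
  · obtain ⟨t, ht, hc⟩ := exists_add_smul_one_ne_zero c (finite_not_injective_add_smul _
      (mulLinearForm I (linearClass I 1) i) h)
    rw [Set.mem_ofPred_eq, not_not, ← mulLinearForm_add_smul] at ht
    obtain ⟨p, hp, hpI, hmul⟩ := hker _ hc
    have h0 := (injective_iff_map_eq_zero _).mp ht ⟨Ideal.Quotient.mkₐ K I p, p, hp, rfl⟩ (by
      apply Subtype.ext
      simp only [mulLinearForm, linearClass, LinearMap.coe_restrict_apply,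
        LinearMap.mulLeft_apply, ← map_mul, ZeroMemClass.coe_zero]
      exact Ideal.Quotient.eq_zero_iff_mem.mpr hmul)
    exact hpI (Ideal.Quotient.eq_zero_iff_mem.mp (congrArg Subtype.val h0))
  · obtain ⟨t, ht, hc⟩ := exists_add_smul_one_ne_zero c (finite_not_surjective_add_smul _
      (mulLinearForm I (linearClass I 1) i) h)
    rw [Set.mem_ofPred_eq, not_not, ← mulLinearForm_add_smul] at ht
    obtain ⟨φ, hI, hl, p, hp, hφ⟩ := hcoker _ hc
    obtain ⟨⟨_, q, hq, rfl⟩, hqp⟩ := ht ⟨Ideal.Quotient.mkₐ K I p, p, hp, rfl⟩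
    have h1 := congrArg Subtype.val hqp
    simp only [mulLinearForm, linearClass, LinearMap.coe_restrict_apply,
      LinearMap.mulLeft_apply] at h1
    have h2 : linearForm (c + t • 1) * q - p ∈ I := by
      rw [← Ideal.Quotient.eq]
      exact h1
    have h3 := hI _ h2
    rw [map_sub, hl, zero_sub, neg_eq_zero] at h3
    exact hφ h3

/-! ### Kernel elements from counting classes of monomials -/

/-- The monomial with exponent `a` is not in the ideal `(x_1^d, …, x_n^d, x^u)`. -/
def IsStandard {n : ℕ} (d : ℕ) (u a : Fin n →₀ ℕ) : Prop := (∀ i, a i < d) ∧ ¬ u ≤ a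

theorem mem_powersAnd_monomial {K : Type*} [Field K] {n : ℕ} {d : ℕ} {u : Fin n →₀ ℕ}
    {p : MvPolynomial (Fin n) K} :
    p ∈ powersAnd d (monomial u 1) ↔ ∀ a ∈ p.support, ¬ IsStandard d u a := by
  have : powersAnd d (monomial u (1 : K)) = Ideal.span ((fun s => monomial s (1 : K)) ''
      (Set.range (fun i : Fin n => Finsupp.single i d) ∪ {u})) := by
    rw [powersAnd, Set.image_union, Set.image_singleton, ← Set.range_comp]
    congr 3
    ext i
    simp [X_pow_eq_monomial]
  rw [this, mem_ideal_span_monomial_image]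
  refine forall₂_congr fun a _ => ?_
  simp only [Set.mem_union, Set.mem_range, Set.mem_singleton_iff, IsStandard, not_and_or,
    not_forall, not_lt, not_not]
  constructor
  · rintro ⟨_, ⟨i, rfl⟩ | rfl, h⟩
    · exact Or.inl ⟨i, by simpa using h⟩
    · exact Or.inr h
  · rintro (⟨i, h⟩ | h)
    · exact ⟨_, Or.inl ⟨i, rfl⟩, by simpa using h⟩
    · exact ⟨_, Or.inr rfl, h⟩

theorem coeff_linearForm_mul {K : Type*} [Field K] {n : ℕ} (c : Fin n → K)
    (p : MvPolynomial (Fin n) K) (b : Fin n →₀ ℕ) :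
    coeff b (linearForm c * p) =
      ∑ i, if b i ≠ 0 then c i * coeff (b - Finsupp.single i 1) p else 0 := by
  rw [linearForm, Finset.sum_mul, coeff_sum]
  refine Finset.sum_congr rfl fun i _ => ?_
  rw [mul_assoc, coeff_C_mul, coeff_X_mul']
  simp

theorem finite_isStandard {n : ℕ} (d : ℕ) (u : Fin n →₀ ℕ) :
    {a : Fin n →₀ ℕ | IsStandard d u a}.Finite := by
  refine (Set.finite_Iic (Finsupp.equivFunOnFinite.symm fun _ => d)).subset fun a ha => ?_
  intro i
  exact (ha.1 i).le

/-- If monomials are sorted into classes compatibly with multiplication by the sum of the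
variables, and the standard monomials of degree `i` fall into more classes than those of degree
`i + 1`, then multiplication by a linear form with nonzero coefficients is not injective. -/
theorem exists_mul_mem_of_ncard_lt {K : Type*} [Field K] {n : ℕ} {d i : ℕ} {u : Fin n →₀ ℕ}
    {T : Type*} (q : (Fin n →₀ ℕ) → T)
    (hq : ∀ (f : T → K) (a b : Fin n →₀ ℕ), q a = q b →
      (∑ j, if a j ≠ 0 then f (q (a - Finsupp.single j 1)) else 0) =
        ∑ j, if b j ≠ 0 then f (q (b - Finsupp.single j 1)) else 0)
    (hstd : ∀ a b, q a = q b → IsStandard d u a → IsStandard d u b)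
    (hdeg : ∀ a b, q a = q b → a.degree = b.degree)
    (hcard : (q '' {a | IsStandard d u a ∧ a.degree = i + 1}).ncard <
      (q '' {a | IsStandard d u a ∧ a.degree = i}).ncard)
    (c : Fin n → K) (hc : ∀ j, c j ≠ 0) :
    ∃ p : MvPolynomial (Fin n) K, p.IsHomogeneous i ∧ p ∉ powersAnd d (monomial u (1 : K)) ∧
      linearForm c * p ∈ powersAnd d (monomial u (1 : K)) := by
  classical
  have hfin : ∀ i, {a | IsStandard d u a ∧ a.degree = i}.Finite := fun i =>
    (finite_isStandard d u).subset fun a ha => ha.1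
  set A : ℕ → Set T := fun i => q '' {a | IsStandard d u a ∧ a.degree = i} with hA
  have hAfin : ∀ i, (A i).Finite := fun i => (hfin i).image q
  have : Fintype (A i) := (hAfin i).fintype
  have : Fintype (A (i + 1)) := (hAfin (i + 1)).fintype
  let ext : (A i → K) →ₗ[K] (T → K) :=
    { toFun := fun f t => if h : t ∈ A i then f ⟨t, h⟩ else 0
      map_add' := fun f g => by ext t; by_cases h : t ∈ A i <;> simp [h]
      map_smul' := fun r f => by ext t; by_cases h : t ∈ A i <;> simp [h] }
  have hext : ∀ (f : A i → K) (t : T) (h : t ∈ A i), ext f t = f ⟨t, h⟩ := fun f t h => by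
    simp [ext, h]
  have hext0 : ∀ (f : A i → K) (t : T), t ∉ A i → ext f t = 0 := fun f t h => by
    simp [ext, h]
  choose rep hrep hqrep using fun τ : A (i + 1) => τ.2
  -- Multiplication by the sum of the variables, modulo the ideal, on polynomials whose coefficients
  -- are constant on classes. By `hq` the chosen representatives do not matter.
  let L : (A i → K) →ₗ[K] (A (i + 1) → K) :=
    { toFun := fun f τ => ∑ j, if rep τ j ≠ 0 then
        ext f (q (rep τ - Finsupp.single j 1)) else 0
      map_add' := fun f g => by
        ext τ
        simp only [map_add, Pi.add_apply, ← Finset.sum_add_distrib]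
        refine Finset.sum_congr rfl fun j _ => ?_
        split_ifs <;> simp
      map_smul' := fun r f => by
        ext τ
        simp only [map_smul, Pi.smul_apply, smul_eq_mul, Finset.mul_sum, RingHom.id_apply]
        refine Finset.sum_congr rfl fun j _ => ?_
        split_ifs <;> simp }
  have hker : L.ker ≠ ⊥ := by
    refine LinearMap.ker_ne_bot_of_finrank_lt ?_
    rw [Module.finrank_pi, Module.finrank_pi, ← Nat.card_eq_fintype_card,
      ← Nat.card_eq_fintype_card]
    exact hcard
  obtain ⟨f, hf, hf0⟩ := (Submodule.ne_bot_iff _).mp hker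
  have hLf : ∀ τ, (∑ j, if rep τ j ≠ 0 then
      ext f (q (rep τ - Finsupp.single j 1)) else 0) = 0 := fun τ => congrFun hf τ
  have hcpow : ∀ a : Fin n →₀ ℕ, (∏ j, c j ^ a j) ≠ 0 := fun a =>
    Finset.prod_ne_zero_iff.mpr fun j _ => pow_ne_zero _ (hc j)
  -- The factor c^a undoes the rescaling: the coefficient of x^b in ℓp is c^b times the one obtained
  -- for the sum of the variables.
  set p : MvPolynomial (Fin n) K :=
    ∑ a ∈ (hfin i).toFinset, monomial a ((∏ j, c j ^ a j) * ext f (q a)) with hp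
  have hpc : ∀ a, coeff a p = (∏ j, c j ^ a j) * ext f (q a) := by
    intro a
    rw [hp, coeff_sum]
    simp only [coeff_monomial, Finset.sum_ite_eq', Set.Finite.mem_toFinset, Set.mem_ofPred_eq]
    split_ifs with h
    · rfl
    · rw [hext0, mul_zero]
      rintro ⟨b, ⟨hb, hb'⟩, hab⟩
      exact h ⟨hstd b a hab hb, by rw [← hdeg b a hab, hb']⟩
  refine ⟨p, ?_, ?_, ?_⟩
  · refine IsHomogeneous.sum _ _ _ fun a ha => isHomogeneous_monomial _ ?_
    simpa using ((hfin i).mem_toFinset.mp ha).2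
  · rw [mem_powersAnd_monomial]
    push Not
    obtain ⟨⟨τ, a, ha, rfl⟩, hτ⟩ := Function.ne_iff.mp hf0
    refine ⟨a, ?_, ha.1⟩
    rw [mem_support_iff, hpc]
    refine mul_ne_zero (hcpow a) ?_
    rw [hext]
    exact hτ
  · rw [mem_powersAnd_monomial]
    intro b hb hbstd
    rw [mem_support_iff] at hb
    refine hb ?_
    by_cases hbd : b.degree = i + 1
    · have hb1 : q b ∈ A (i + 1) := ⟨b, ⟨hbstd, hbd⟩, rfl⟩
      have h1 := hLf ⟨q b, hb1⟩
      rw [hq (ext f) _ b (hqrep ⟨q b, hb1⟩)] at h1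
      rw [coeff_linearForm_mul]
      calc _ = ∑ j, (∏ l, c l ^ b l) *
            (if b j ≠ 0 then ext f (q (b - Finsupp.single j 1)) else 0) := by
            refine Finset.sum_congr rfl fun j _ => ?_
            split_ifs with hj
            · rw [hpc, ← mul_assoc]
              congr 1
              rw [← Finset.mul_prod_erase _ _ (Finset.mem_univ j),
                ← Finset.mul_prod_erase _ (fun l => c l ^ b l) (Finset.mem_univ j), ← mul_assoc]
              congr 1
              · rw [Finsupp.tsub_apply, Finsupp.single_eq_same, mul_pow_sub_one hj]
              · refine Finset.prod_congr rfl fun l hl => ?_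
                rw [Finsupp.tsub_apply, Finsupp.single_eq_of_ne (Finset.ne_of_mem_erase hl),
                  Nat.sub_zero]
            · simp
        _ = 0 := by rw [← Finset.mul_sum, h1, mul_zero]
    · have hhom : (linearForm c * p).IsHomogeneous (1 + i) := by
        refine (linearForm_isHomogeneous c).mul ?_
        refine IsHomogeneous.sum _ _ _ fun a ha => isHomogeneous_monomial _ ?_
        simpa using ((hfin i).mem_toFinset.mp ha).2
      exact hhom.coeff_eq_zero (by omega)

/-! ### Counting monomials by core and tail exponents -/

/-- The number of monomials of degree `i` in `k` variables with all exponents less than `d`, as a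
function of an integer `i`. -/
def boxCount (d : ℕ) : ℕ → ℤ → ℤ
  | 0, i => if i = 0 then 1 else 0
  | k + 1, i => ∑ j ∈ Finset.range d, boxCount d k (i - j)

theorem sum_ite_sum_eq_boxCount (d k : ℕ) (i : ℤ) :
    (∑ g : Fin k → Fin d, if (∑ j, ((g j : ℕ) : ℤ)) = i then (1 : ℤ) else 0) = boxCount d k i := by
  induction k generalizing i with
  | zero => simp [boxCount, eq_comm]
  | succ k ih =>
    rw [boxCount, ← Equiv.sum_comp (Fin.consEquiv fun _ => Fin d), Fintype.sum_prod_type,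
      ← Fin.sum_univ_eq_sum_range (fun j => boxCount d k (i - j)) d]
    refine Finset.sum_congr rfl fun a _ => ?_
    rw [← ih]
    refine Finset.sum_congr rfl fun g _ => ?_
    simp only [Fin.consEquiv_apply, Fin.sum_univ_succ, Fin.cons_zero, Fin.cons_succ]
    congr 1
    rw [eq_sub_iff_add_eq, add_comm]

/-- The exponents of the first `p` variables. -/
def coreExp {p k : ℕ} (a : Fin (p + k) →₀ ℕ) (j : Fin p) : ℕ := a (Fin.castAdd k j)

/-- The exponents of the last `k` variables. -/
def tailExp {p k : ℕ} (a : Fin (p + k) →₀ ℕ) (j : Fin k) : ℕ := a (Fin.natAdd p j)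

theorem degree_eq_core_add_tail {p k : ℕ} (a : Fin (p + k) →₀ ℕ) :
    a.degree = ∑ j, coreExp a j + ∑ j, tailExp a j := by
  rw [Finsupp.degree_eq_sum, Fin.sum_univ_add]
  rfl

theorem coreExp_sub_castAdd {p k : ℕ} (a : Fin (p + k) →₀ ℕ) (j : Fin p) :
    coreExp (a - Finsupp.single (Fin.castAdd k j) 1) = coreExp a - Pi.single j 1 := by
  ext l
  simp only [coreExp, Finsupp.tsub_apply, Pi.sub_apply, Finsupp.single_apply, Pi.single_apply,
    Fin.castAdd_inj, eq_comm]

theorem tailExp_sub_castAdd {p k : ℕ} (a : Fin (p + k) →₀ ℕ) (j : Fin p) :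
    tailExp (a - Finsupp.single (Fin.castAdd k j) 1) = tailExp a := by
  ext l
  have : Fin.castAdd k j ≠ Fin.natAdd p l := by
    intro h
    have := congrArg Fin.val h
    simp at this
    omega
  simp [tailExp, this]

theorem coreExp_sub_natAdd {p k : ℕ} (a : Fin (p + k) →₀ ℕ) (j : Fin k) :
    coreExp (a - Finsupp.single (Fin.natAdd p j) 1) = coreExp a := by
  ext l
  have : Fin.natAdd p j ≠ Fin.castAdd k l := by
    intro h
    have := congrArg Fin.val h
    simp at this
    omega
  simp [coreExp, this]

theorem tailExp_sub_natAdd {p k : ℕ} (a : Fin (p + k) →₀ ℕ) (j : Fin k) :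
    tailExp (a - Finsupp.single (Fin.natAdd p j) 1) = tailExp a - Pi.single j 1 := by
  ext l
  simp only [tailExp, Finsupp.tsub_apply, Pi.sub_apply, Finsupp.single_apply, Pi.single_apply,
    Fin.natAdd_inj, eq_comm]

/-- The exponent vector with prescribed core and tail. -/
noncomputable def appendExp {p k : ℕ} (x : Fin p → ℕ) (y : Fin k → ℕ) : Fin (p + k) →₀ ℕ :=
  Finsupp.equivFunOnFinite.symm (Fin.append x y)

theorem coreExp_appendExp {p k : ℕ} (x : Fin p → ℕ) (y : Fin k → ℕ) :
    coreExp (appendExp x y) = x := by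
  ext j; simp [coreExp, appendExp]

theorem tailExp_appendExp {p k : ℕ} (x : Fin p → ℕ) (y : Fin k → ℕ) :
    tailExp (appendExp x y) = y := by
  ext j; simp [tailExp, appendExp]

/-- Count of the classes of standard monomials of degree `i`, when the exponents of the first `p`
variables are only recorded through `κ`. -/
theorem ncard_image_isStandard {p k d : ℕ} {T : Type*} {u : Fin (p + k) →₀ ℕ}
    (κ : (Fin p → ℕ) → T) (P : (Fin p → ℕ) → Prop) (w : T → ℕ) (C₀ : Finset T)
    (hw : ∀ x, w (κ x) = ∑ j, x j)
    (hstd : ∀ a, IsStandard d u a ↔ P (coreExp a) ∧ ∀ j, tailExp a j < d)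
    (hC : ∀ μ, μ ∈ C₀ ↔ ∃ x, P x ∧ κ x = μ) (i : ℕ) :
    (((fun a => (κ (coreExp a), tailExp a)) ''
      {a | IsStandard d u a ∧ a.degree = i}).ncard : ℤ) =
      ∑ μ ∈ C₀, boxCount d k (i - w μ) := by
  classical
  set F : Finset (T × (Fin k → Fin d)) := (C₀ ×ˢ Finset.univ).filter fun x =>
    (∑ j, ((x.2 j : ℕ) : ℤ)) = i - w x.1 with hF
  have hinj : Function.Injective
      (fun x : T × (Fin k → Fin d) => ((x.1, fun j => (x.2 j : ℕ)) : T × (Fin k → ℕ))) := by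
    rintro ⟨x, y⟩ ⟨x', y'⟩ h
    simp only [Prod.mk.injEq, funext_iff, ← Fin.ext_iff] at h
    exact Prod.ext h.1 (funext h.2)
  have himg : (fun a : Fin (p + k) →₀ ℕ => (κ (coreExp a), tailExp a)) ''
      {a | IsStandard d u a ∧ a.degree = i} =
      (F.image fun x => ((x.1, fun j => (x.2 j : ℕ)) : T × (Fin k → ℕ)) : Finset _) := by
    ext ⟨μ, y⟩
    simp only [Set.mem_image, Set.mem_ofPred_eq, Prod.mk.injEq, Finset.coe_image, hF,
      Finset.coe_filter, Finset.mem_product, Finset.mem_univ, and_true, Prod.exists]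
    constructor
    · rintro ⟨a, ⟨ha, hai⟩, rfl, rfl⟩
      obtain ⟨h1, h2⟩ := (hstd a).mp ha
      refine ⟨_, fun j => ⟨tailExp a j, h2 j⟩, ⟨(hC _).mpr ⟨_, h1, rfl⟩, ?_⟩, rfl, rfl⟩
      rw [hw, ← hai, degree_eq_core_add_tail]
      push_cast
      ring
    · rintro ⟨μ, g, ⟨hμ, hg⟩, rfl, rfl⟩
      obtain ⟨x, hx, rfl⟩ := (hC _).mp hμ
      refine ⟨appendExp x fun j => (g j : ℕ), ⟨?_, ?_⟩, ?_, ?_⟩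
      · rw [hstd, coreExp_appendExp, tailExp_appendExp]
        exact ⟨hx, fun j => (g j).2⟩
      · rw [degree_eq_core_add_tail, coreExp_appendExp, tailExp_appendExp]
        rw [hw] at hg
        zify
        push_cast at hg
        linarith
      · rw [coreExp_appendExp]
      · rw [tailExp_appendExp]
  rw [himg, Set.ncard_coe_finset, Finset.card_image_of_injective _ hinj, hF, Finset.card_filter]
  push_cast
  rw [Finset.sum_product]
  exact Finset.sum_congr rfl fun μ _ => sum_ite_sum_eq_boxCount d k (i - w μ)

theorem pi_sub_single_comp_perm {p : ℕ} (x : Fin p → ℕ) (σ : Equiv.Perm (Fin p)) (j : Fin p) :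
    (x ∘ σ) - Pi.single j 1 = (x - Pi.single (σ j) 1) ∘ σ := by
  ext l
  simp [Pi.single_apply, σ.injective.eq_iff]

/-- Non-injectivity from a count of symmetric classes of standard monomials. -/
theorem exists_mul_mem_of_boxCount_lt {K : Type*} [Field K] {p k d i : ℕ} {T : Type*}
    {u : Fin (p + k) →₀ ℕ}
    (κ : (Fin p → ℕ) → T) (P : (Fin p → ℕ) → Prop) (w : T → ℕ) (C₀ : Finset T)
    (hκ : ∀ x y, κ x = κ y → ∃ σ : Equiv.Perm (Fin p), y = x ∘ σ ∧ ∀ z, κ (z ∘ σ) = κ z)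
    (hP : ∀ x y, κ x = κ y → P x → P y)
    (hw : ∀ x, w (κ x) = ∑ j, x j)
    (hstd : ∀ a, IsStandard d u a ↔ P (coreExp a) ∧ ∀ j, tailExp a j < d)
    (hC : ∀ μ, μ ∈ C₀ ↔ ∃ x, P x ∧ κ x = μ)
    (hlt : ∑ μ ∈ C₀, boxCount d k ((i : ℤ) + 1 - w μ) < ∑ μ ∈ C₀, boxCount d k (i - w μ))
    (c : Fin (p + k) → K) (hc : ∀ j, c j ≠ 0) :
    ∃ f : MvPolynomial (Fin (p + k)) K, f.IsHomogeneous i ∧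
      f ∉ powersAnd d (monomial u (1 : K)) ∧
      linearForm c * f ∈ powersAnd d (monomial u (1 : K)) := by
  refine exists_mul_mem_of_ncard_lt (fun a => (κ (coreExp a), tailExp a)) ?_ ?_ ?_ ?_ c hc
  · intro f a b hab
    obtain ⟨hab1, hab2⟩ := Prod.mk.injEq .. ▸ hab
    obtain ⟨σ, hσ, hσκ⟩ := hκ _ _ hab1
    rw [Fin.sum_univ_add, Fin.sum_univ_add]
    congr 1
    -- Lowering entry j of the permuted core is lowering entry σ j of the original and then
    -- permuting, so reindexing by σ matches the terms.
    · rw [← Equiv.sum_comp σ]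
      refine Finset.sum_congr rfl fun j _ => ?_
      rw [coreExp_sub_castAdd, coreExp_sub_castAdd, tailExp_sub_castAdd, tailExp_sub_castAdd,
        hab2, hσ, pi_sub_single_comp_perm, hσκ]
      have : b (Fin.castAdd k j) = a (Fin.castAdd k (σ j)) := congrFun hσ j
      rw [this]
    · refine Finset.sum_congr rfl fun j _ => ?_
      rw [coreExp_sub_natAdd, coreExp_sub_natAdd, tailExp_sub_natAdd, tailExp_sub_natAdd,
        hab1, hab2]
      have : a (Fin.natAdd p j) = b (Fin.natAdd p j) := congrFun hab2 j
      rw [this]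
  · intro a b hab
    obtain ⟨hab1, hab2⟩ := Prod.mk.injEq .. ▸ hab
    rw [hstd, hstd, hab2]
    exact fun h => ⟨hP _ _ hab1 h.1, h.2⟩
  · intro a b hab
    obtain ⟨hab1, hab2⟩ := Prod.mk.injEq .. ▸ hab
    rw [degree_eq_core_add_tail, degree_eq_core_add_tail, ← hw, ← hw, hab1, hab2]
  · have h1 := ncard_image_isStandard κ P w C₀ hw hstd hC i
    have h2 := ncard_image_isStandard κ P w C₀ hw hstd hC (i + 1)
    push_cast at h2
    rw [← h1, ← h2] at hlt
    exact Nat.cast_lt.mp hlt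

/-- Non-injectivity for the ideal generated by the `d`-th powers of the variables and the `e`-th
power of the product of the first `p` variables, from a count of monomials with sorted core. -/
theorem exists_mul_mem_of_sorted_boxCount_lt {K : Type*} [Field K] {p k d e i : ℕ}
    {u : Fin (p + k) →₀ ℕ} (hu : u = appendExp (fun _ => e) 0)
    (C₀ : Finset (Fin p → ℕ))
    (hC : ∀ μ, μ ∈ C₀ ↔ Monotone μ ∧ (∀ j, μ j < d) ∧ ∃ j, μ j < e)
    (hlt : ∑ μ ∈ C₀, boxCount d k ((i : ℤ) + 1 - (∑ j, μ j : ℕ)) <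
      ∑ μ ∈ C₀, boxCount d k (i - (∑ j, μ j : ℕ)))
    (c : Fin (p + k) → K) (hc : ∀ j, c j ≠ 0) :
    ∃ f : MvPolynomial (Fin (p + k)) K, f.IsHomogeneous i ∧
      f ∉ powersAnd d (monomial u (1 : K)) ∧
      linearForm c * f ∈ powersAnd d (monomial u (1 : K)) := by
  have hperm : ∀ x y : Fin p → ℕ, x ∘ Tuple.sort x = y ∘ Tuple.sort y →
      y = x ∘ ((Tuple.sort y)⁻¹.trans (Tuple.sort x) : Equiv.Perm (Fin p)) := by
    intro x y h
    ext j
    have := congrFun h ((Tuple.sort y)⁻¹ j)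
    simpa using this.symm
  refine exists_mul_mem_of_boxCount_lt (fun x => x ∘ Tuple.sort x)
    (fun x => (∀ j, x j < d) ∧ ∃ j, x j < e) (fun μ => ∑ j, μ j) C₀ ?_ ?_ ?_ ?_ ?_ hlt c hc
  · intro x y h
    exact ⟨_, hperm x y h, fun z => Tuple.comp_perm_comp_sort_eq_comp_sort⟩
  · rintro x y h ⟨h1, j, h2⟩
    rw [hperm x y h]
    refine ⟨fun l => h1 _, (((Tuple.sort y)⁻¹.trans (Tuple.sort x)).symm j), ?_⟩
    simpa only [Function.comp_apply, Equiv.apply_symm_apply] using h2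
  · intro x
    exact Equiv.sum_comp (Tuple.sort x) x
  · intro a
    rw [IsStandard, Fin.forall_fin_add]
    have : u ≤ a ↔ ∀ j, e ≤ coreExp a j := by
      rw [hu]
      refine ⟨fun h j => by simpa [appendExp, coreExp] using h (Fin.castAdd k j), fun h j => ?_⟩
      induction j using Fin.addCases with
      | left j => simpa [appendExp, coreExp] using h j
      | right j => simp [appendExp]
    rw [this]
    push Not
    simp only [coreExp, tailExp]
    tauto
  · intro μ
    rw [hC]
    constructor
    · rintro ⟨h1, h2⟩
      refine ⟨μ, h2, ?_⟩
      rw [Tuple.sort_eq_refl_iff_monotone.mpr h1]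
      rfl
    · rintro ⟨x, ⟨h1, j, h2⟩, rfl⟩
      refine ⟨Tuple.monotone_sort x, fun l => h1 _, (Tuple.sort x).symm j, ?_⟩
      simpa only [Function.comp_apply, Equiv.apply_symm_apply] using h2

/-! ### Symmetry and unimodality of the coefficients of (1 + t + ⋯ + t^(d-1))^k -/

/-- With P_k = (1 + ⋯ + t^(d-1))^k, this is (1 - t) P_(k+1) = (1 - t^d) P_k. It reduces monotonicity
for k + 1 variables to comparing two values for k variables. -/
theorem boxCount_succ_add_one_sub (d k : ℕ) (i : ℤ) :
    boxCount d (k + 1) (i + 1) - boxCount d (k + 1) i =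
      boxCount d k (i + 1) - boxCount d k (i + 1 - d) := by
  have h1 := Finset.sum_range_succ (fun j : ℕ => boxCount d k (i + 1 - j)) d
  have h2 := Finset.sum_range_succ' (fun j : ℕ => boxCount d k (i + 1 - j)) d
  have h3 : ∀ j : ℕ, i + 1 - ((j + 1 : ℕ) : ℤ) = i - j := fun j => by push_cast; ring
  simp only [h3] at h2
  simp only [boxCount]
  simp only [Nat.cast_zero, sub_zero] at h2
  linarith

theorem boxCount_symm (d k : ℕ) (i j : ℤ) (h : i + j = k * ((d : ℤ) - 1)) :
    boxCount d k i = boxCount d k j := by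
  induction k generalizing i j with
  | zero =>
    have : i = 0 ↔ j = 0 := by simp at h; omega
    simp [boxCount, this]
  | succ k ih =>
    rw [boxCount, boxCount, ← Finset.sum_range_reflect]
    refine Finset.sum_congr rfl fun l hl => ih _ _ ?_
    have hl' := Finset.mem_range.mp hl
    rw [Nat.sub_sub, Nat.cast_sub (by omega)]
    push_cast at h ⊢
    linarith

/-- Reflection in the centre k(d-1)/2 moves both arguments to the left half, where stepwise growth
is enough. -/
theorem boxCount_le_of_step {d k : ℕ}
    (hstep : ∀ i : ℤ, 2 * i + 1 ≤ k * ((d : ℤ) - 1) → boxCount d k i ≤ boxCount d k (i + 1))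
    {i j : ℤ} (h : |2 * i - k * ((d : ℤ) - 1)| ≤ |2 * j - k * ((d : ℤ) - 1)|) :
    boxCount d k j ≤ boxCount d k i := by
  have hmono : ∀ j i : ℤ, j ≤ i → 2 * i ≤ k * ((d : ℤ) - 1) →
      boxCount d k j ≤ boxCount d k i := by
    intro j i hji
    induction i, hji using Int.leInduction with
    | base => exact fun _ => le_rfl
    | succ i hji ih => exact fun h => (ih (by linarith)).trans (hstep i (by linarith))
  have hrefl : ∀ i : ℤ, ∃ i', 2 * i' - k * ((d : ℤ) - 1) = - |2 * i - k * ((d : ℤ) - 1)| ∧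
      boxCount d k i = boxCount d k i' := by
    intro i
    rcases le_total (2 * i - k * ((d : ℤ) - 1)) 0 with hi | hi
    · exact ⟨i, by rw [abs_of_nonpos hi, neg_neg], rfl⟩
    · exact ⟨k * ((d : ℤ) - 1) - i, by rw [abs_of_nonneg hi]; ring,
        boxCount_symm d k _ _ (by ring)⟩
  obtain ⟨i', hi', hi⟩ := hrefl i
  obtain ⟨j', hj', hj⟩ := hrefl j
  rw [hi, hj]
  have := abs_nonneg (2 * i - k * ((d : ℤ) - 1))
  exact hmono _ _ (by linarith) (by linarith)

/-- The coefficients of `(1 + t + ⋯ + t^(d-1))^k` decrease away from the middle. -/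
theorem boxCount_le {d k : ℕ} {i j : ℤ}
    (h : |2 * i - k * ((d : ℤ) - 1)| ≤ |2 * j - k * ((d : ℤ) - 1)|) :
    boxCount d k j ≤ boxCount d k i := by
  induction k generalizing i j with
  | zero =>
    refine boxCount_le_of_step (fun i hi => ?_) h
    have h1 : i ≠ 0 := by rintro rfl; simp at hi
    simp only [boxCount, h1, if_false]
    split_ifs <;> simp
  | succ k ih =>
    refine boxCount_le_of_step (fun i hi => ?_) h
    have h1 := boxCount_succ_add_one_sub d k i
    have h2 : boxCount d k (i + 1 - d) ≤ boxCount d k (i + 1) := by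
      refine ih ?_
      push_cast at hi
      -- With A = 2(i + 1) - k(d - 1), the squared distances to the centre differ by (A - 2d)² - A²
      -- = 4d(d - A), and `hi` says A ≤ d.
      rw [← sq_le_sq]
      have hd : (0 : ℤ) ≤ d := Nat.cast_nonneg d
      nlinarith [mul_nonneg hd (show (0 : ℤ) ≤ d - (2 * (i + 1) - k * ((d : ℤ) - 1)) by linarith)]
    linarith

/-- For k = 1 the coefficients are flat, so the induction starts at k = 2, where the coefficients
climb by 1 up to the centre. -/
theorem boxCount_lt_succ {d k : ℕ} (hd : 2 ≤ d) (hk : 2 ≤ k) {i : ℤ} (hi : 0 ≤ i)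
    (hi' : 2 * i ≤ k * ((d : ℤ) - 1)) : boxCount d k (i - 1) < boxCount d k i := by
  induction k, hk using Nat.le_induction generalizing i with
  | base =>
    have h1 := boxCount_succ_add_one_sub d 1 (i - 1)
    rw [sub_add_cancel] at h1
    have h2 : boxCount d 1 i = 1 := by
      have : (i.toNat : ℤ) = i := Int.toNat_of_nonneg hi
      simp only [boxCount]
      rw [Finset.sum_eq_single_of_mem i.toNat]
      · simp [this]
      · rw [Finset.mem_range]; push_cast at hi'; omega
      · intro b _ hb
        rw [if_neg]
        omega
    have h3 : boxCount d 1 (i - d) = 0 := by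
      simp only [boxCount]
      refine Finset.sum_eq_zero fun b _ => ?_
      rw [if_neg]
      push_cast at hi'
      omega
    linarith
  | succ k hk ih =>
    have h1 := boxCount_succ_add_one_sub d k (i - 1)
    rw [sub_add_cancel] at h1
    have hk' : (2 : ℤ) ≤ k := by exact_mod_cast hk
    have hd' : (2 : ℤ) ≤ d := by exact_mod_cast hd
    push_cast at hi'
    rcases le_or_gt (2 * i) (k * ((d : ℤ) - 1)) with h | h
    · have h2 := ih hi h
      have h3 : boxCount d k (i - d) ≤ boxCount d k (i - 1) := by
        refine boxCount_le ?_
        rw [abs_of_nonpos (by linarith), abs_of_nonpos (by linarith)]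
        linarith
      linarith
    -- Here i is past the centre for k variables, so the induction hypothesis is applied to its
    -- mirror image; i - d is still at least as far from the centre as the predecessor of that
    -- image.
    · have hj : 0 ≤ k * ((d : ℤ) - 1) - i := by nlinarith
      have h2 := ih hj (by linarith)
      rw [boxCount_symm d k (k * ((d : ℤ) - 1) - i) i (by ring)] at h2
      have h3 : boxCount d k (i - d) ≤ boxCount d k (k * ((d : ℤ) - 1) - i - 1) := by
        refine boxCount_le ?_
        rw [abs_of_nonpos (by linarith), abs_of_nonpos (by linarith)]
        linarith
      linarith

/-- The coefficients of `(1 + t + ⋯ + t^(d-1))^k` strictly decrease away from the middle when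
`k ≥ 2`. -/
theorem boxCount_lt {d k : ℕ} (hd : 2 ≤ d) (hk : 2 ≤ k) {i j : ℤ}
    (h : |2 * i - k * ((d : ℤ) - 1)| < |2 * j - k * ((d : ℤ) - 1)|)
    (hi : |2 * i - k * ((d : ℤ) - 1)| ≤ k * ((d : ℤ) - 1)) :
    boxCount d k j < boxCount d k i := by
  have key : ∀ i : ℤ, |2 * i - k * ((d : ℤ) - 1)| < |2 * j - k * ((d : ℤ) - 1)| →
      |2 * i - k * ((d : ℤ) - 1)| ≤ k * ((d : ℤ) - 1) → 2 * i ≤ k * ((d : ℤ) - 1) →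
      boxCount d k j < boxCount d k i := by
    intro i h hi h0
    have h1 : |2 * i - k * ((d : ℤ) - 1)| = k * ((d : ℤ) - 1) - 2 * i := by
      rw [abs_of_nonpos (by linarith)]; ring
    rw [h1] at h hi
    refine (boxCount_le ?_).trans_lt (boxCount_lt_succ hd hk (by linarith) h0)
    rw [abs_of_nonpos (by linarith)]
    rcases abs_cases (2 * j - k * ((d : ℤ) - 1)) with ⟨h2, _⟩ | ⟨h2, _⟩
    · rw [h2] at h ⊢
      generalize (k : ℤ) * ((d : ℤ) - 1) = c at *
      omega
    · rw [h2] at h ⊢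
      generalize (k : ℤ) * ((d : ℤ) - 1) = c at *
      omega
  rcases le_total (2 * i) (k * ((d : ℤ) - 1)) with h0 | h0
  · exact key i h hi h0
  · rw [boxCount_symm d k i (k * ((d : ℤ) - 1) - i) (by ring)]
    have h1 : |2 * (k * ((d : ℤ) - 1) - i) - k * ((d : ℤ) - 1)| =
        |2 * i - k * ((d : ℤ) - 1)| := by
      rw [← abs_neg]; congr 1; ring
    exact key _ (h1 ▸ h) (h1 ▸ hi) (by linarith)

/-! ### Dimension drop for a generator in two variables -/

theorem sum_Ico_boxCount_sub (d k : ℕ) (x : ℤ) {a b : ℕ} (hab : a ≤ b) :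
    ∑ j ∈ Finset.Ico a b, (boxCount d k (x - j) - boxCount d k (x - 1 - j)) =
      boxCount d k (x - a) - boxCount d k (x - b) := by
  induction b, hab using Nat.le_induction with
  | base => simp
  | succ b hab ih =>
    rw [Finset.sum_Ico_succ_top hab, ih]
    push_cast
    rw [show x - 1 - (b : ℤ) = x - (b + 1) by ring]
    ring

/-- The hypothesis reads ρ 0 + ρ (e + 1) < ρ 1 + ρ e. Monotonicity bounds the last term on the left
by ρ (e + 1), and the remaining terms are compared one by one. -/
theorem sum_lt_sum_of_antitone_odd {ρ : ℕ → ℤ} (hρ : Antitone ρ) {e : ℕ} (he : 2 ≤ e)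
    (h : ρ 0 - ρ 1 < ρ e - ρ (e + 1)) :
    ρ 0 + ∑ j ∈ Finset.range (e - 1), ρ (e + 2 + j) < ∑ j ∈ Finset.range e, ρ (1 + j) := by
  obtain ⟨e, rfl⟩ := Nat.exists_eq_add_of_le' he
  rw [show e + 2 - 1 = e + 1 by omega, Finset.sum_range_succ, Finset.sum_range_succ,
    Finset.sum_range_succ']
  have h1 : ∑ j ∈ Finset.range e, ρ (e + 2 + 2 + j) ≤ ∑ j ∈ Finset.range e, ρ (1 + (j + 1)) :=
    Finset.sum_le_sum fun j _ => hρ (by omega)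
  have h2 : ρ (e + 2 + 2 + e) ≤ ρ (e + 2 + 1) := hρ (by omega)
  rw [show 1 + (e + 1) = e + 2 by ring, add_zero]
  linarith

/-- The mechanism is that of the odd case. Bounding the last term ρ (2(e - 1)) by ρ (e + 1) is where
e ≥ 3 is needed. -/
theorem sum_lt_sum_of_antitone_even {ρ : ℕ → ℤ} (hρ : Antitone ρ) {e : ℕ} (he : 3 ≤ e)
    (h : ρ 0 - ρ 1 < ρ e - ρ (e + 1)) :
    ∑ j ∈ Finset.range e, ρ (2 * j) < ∑ j ∈ Finset.range e, ρ (j + 1) := by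
  obtain ⟨e, rfl⟩ := Nat.exists_eq_add_of_le' he
  rw [Finset.sum_range_succ, Finset.sum_range_succ',
    Finset.sum_range_succ (fun j => ρ (j + 1)) (e + 2),
    Finset.sum_range_succ' (fun j => ρ (j + 1)) (e + 1)]
  have h1 : ∑ j ∈ Finset.range (e + 1), ρ (2 * (j + 1)) ≤
      ∑ j ∈ Finset.range (e + 1), ρ (j + 1 + 1) := Finset.sum_le_sum fun j _ => hρ (by omega)
  have h2 : ρ (2 * (e + 2)) ≤ ρ (e + 3 + 1) := hρ (by omega)
  rw [zero_add, mul_zero]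
  rw [show e + 2 + 1 = e + 3 by ring]
  linarith

theorem antitone_boxCount {d k : ℕ} {z : ℤ} (hz : k * ((d : ℤ) - 1) ≤ 2 * z) :
    Antitone fun x : ℕ => boxCount d k (z + x) := by
  intro x y hxy
  refine boxCount_le ?_
  have : (x : ℤ) ≤ y := by exact_mod_cast hxy
  rw [abs_of_nonneg (by linarith), abs_of_nonneg (by linarith)]
  linarith

/-- The count behind non-injectivity when `d = 2e + 1` and the extra generator is
`x_1^(e+1) x_2^e`. -/
theorem sum_boxCount_lt_odd {e k : ℕ} (he : 2 ≤ e) (hk : 3 ≤ k) (s : ℤ)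
    (hs : s = (k + 2) * e) :
    ∑ μ ∈ (Finset.range (2 * e + 1)).sigma
        (fun a => Finset.Ico 0 (if a ≤ e then 2 * e + 1 else e)),
      boxCount (2 * e + 1) k (s - (μ.1 + μ.2 : ℕ)) <
    ∑ μ ∈ (Finset.range (2 * e + 1)).sigma
        (fun a => Finset.Ico 0 (if a ≤ e then 2 * e + 1 else e)),
      boxCount (2 * e + 1) k (s - 1 - (μ.1 + μ.2 : ℕ)) := by
  rw [← sub_neg, ← Finset.sum_sub_distrib, Finset.sum_sigma]
  obtain ⟨k, rfl⟩ := Nat.exists_eq_add_of_le' (show 1 ≤ k by omega)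
  set d := 2 * e + 1 with hd
  have hd' : (d : ℤ) - 1 = 2 * e := by push_cast [hd]; ring
  have he' : (2 : ℤ) ≤ e := by exact_mod_cast he
  have hk' : (2 : ℤ) ≤ k := by exact_mod_cast (show 2 ≤ k by omega)
  -- The centre for the tail variables; ρ records the coefficients from there outwards.
  set z : ℤ := s - 2 * e with hz
  push_cast at hs
  have hzc : 2 * z = ((k + 1 : ℕ) : ℤ) * ((d : ℤ) - 1) := by
    rw [hd', hz, hs]; push_cast; ring
  have hanti := antitone_boxCount (d := d) (k := k + 1) (z := z) hzc.ge
  set ρ : ℕ → ℤ := fun x => boxCount d (k + 1) (z + x) with hρ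
  have inner : ∀ a : ℕ, ∑ b ∈ Finset.Ico 0 (if a ≤ e then d else e),
      (boxCount d (k + 1) (s - (a + b : ℕ)) - boxCount d (k + 1) (s - 1 - (a + b : ℕ))) =
      boxCount d (k + 1) (s - a) - boxCount d (k + 1) (s - a - (if a ≤ e then d else e : ℕ)) := by
    intro a
    have h := sum_Ico_boxCount_sub d (k + 1) (s - a) (Nat.zero_le (if a ≤ e then d else e))
    rw [Nat.cast_zero, sub_zero] at h
    rw [← h]
    refine Finset.sum_congr rfl fun b _ => ?_
    push_cast
    congr 2 <;> ring
  rw [Finset.sum_congr rfl fun a _ => inner a, Finset.sum_sub_distrib]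
  have hA : ∑ a ∈ Finset.range d, boxCount d (k + 1) (s - a) = ∑ j ∈ Finset.range d, ρ j := by
    rw [← Finset.sum_range_reflect ρ]
    refine Finset.sum_congr rfl fun a ha => ?_
    have := Finset.mem_range.mp ha
    simp only [hρ]
    congr 1
    rw [Nat.sub_sub, Nat.cast_sub (by omega)]
    push_cast
    linarith
  have hB : ∑ a ∈ Finset.range d,
      boxCount d (k + 1) (s - a - (if a ≤ e then d else e : ℕ)) =
      ∑ j ∈ Finset.range (e + 1), ρ (1 + j) + ∑ j ∈ Finset.range e, ρ (1 + j) := by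
    rw [show d = (e + 1) + e by omega, Finset.sum_range_add, ← show d = (e + 1) + e by omega]
    congr 1
    · refine Finset.sum_congr rfl fun a ha => ?_
      have := Finset.mem_range.mp ha
      rw [if_pos (by omega)]
      refine boxCount_symm d (k + 1) _ _ ?_
      rw [← hzc]
      push_cast
      linarith
    · refine Finset.sum_congr rfl fun a ha => ?_
      rw [if_neg (by omega)]
      refine boxCount_symm d (k + 1) _ _ ?_
      rw [← hzc]
      push_cast
      linarith
  -- The block ρ 1, …, ρ (e + 1) also occurs in `hB` and cancels.
  have hC : ∑ j ∈ Finset.range d, ρ j =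
      ρ 0 + ∑ j ∈ Finset.range (e + 1), ρ (1 + j) + ∑ j ∈ Finset.range (e - 1), ρ (e + 2 + j) := by
    rw [show d = (1 + (e + 1)) + (e - 1) by omega, Finset.sum_range_add, Finset.sum_range_add]
    simp only [Finset.range_one, Finset.sum_singleton]
    congr 1
    refine Finset.sum_congr rfl fun a _ => ?_
    congr 1
    omega
  -- The drop of ρ at x is the coefficient at z + x + 1 - d minus that at z + x + 1, with one
  -- variable fewer. For x = e the first of these is the central coefficient, which gives
  -- strictness.
  have hgap : ρ 0 - ρ 1 < ρ e - ρ (e + 1) := by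
    have h0 := boxCount_succ_add_one_sub d k z
    have h1 := boxCount_succ_add_one_sub d k (z + e)
    have hzk : 2 * z - k * ((d : ℤ) - 1) = 2 * e := by
      rw [hzc]; push_cast; rw [hd']; ring
    have h2 : boxCount d k (z + 1 - d) < boxCount d k (z + e + 1 - d) := by
      refine boxCount_lt (by omega) (by omega) ?_ ?_
      · rw [show 2 * (z + e + 1 - d) - k * ((d : ℤ) - 1) = 0 by linarith,
          show 2 * (z + 1 - d) - k * ((d : ℤ) - 1) = -(2 * e) by linarith, abs_neg,
          abs_of_nonneg (by linarith : (0 : ℤ) ≤ 2 * e)]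
        simp; linarith
      · rw [show 2 * (z + e + 1 - d) - k * ((d : ℤ) - 1) = 0 by linarith, hd', abs_zero]
        positivity
    have h3 : boxCount d k (z + e + 1) ≤ boxCount d k (z + 1) := by
      refine boxCount_le ?_
      rw [abs_of_nonneg (by linarith), abs_of_nonneg (by linarith)]
      linarith
    simp only [hρ]
    push_cast
    rw [add_zero, ← add_assoc]
    linarith
  have := sum_lt_sum_of_antitone_odd hanti he hgap
  rw [hA, hB, hC]
  linarith

/-- The count behind non-injectivity when `d = 2e` and the extra generator is `x_1^e x_2^e`. -/
theorem sum_boxCount_lt_even {e k : ℕ} (he : 3 ≤ e) (hk : 3 ≤ k) (s : ℤ)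
    (hs : 2 * s + 1 = (k + 2) * (2 * e - 1)) :
    ∑ μ ∈ (Finset.range e).sigma (fun a => Finset.Ico a (2 * e)),
      boxCount (2 * e) k (s - (μ.1 + μ.2 : ℕ)) <
    ∑ μ ∈ (Finset.range e).sigma (fun a => Finset.Ico a (2 * e)),
      boxCount (2 * e) k (s - 1 - (μ.1 + μ.2 : ℕ)) := by
  rw [← sub_neg, ← Finset.sum_sub_distrib, Finset.sum_sigma]
  obtain ⟨k, rfl⟩ := Nat.exists_eq_add_of_le' (show 1 ≤ k by omega)
  set d := 2 * e with hd
  have hd' : (d : ℤ) - 1 = 2 * e - 1 := by push_cast [hd]; ring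
  have he' : (3 : ℤ) ≤ e := by exact_mod_cast he
  have hk' : (2 : ℤ) ≤ k := by exact_mod_cast (show 2 ≤ k by omega)
  -- The tail centre is now a half-integer, and z is the first integer to its right; hence the + 1
  -- in `hzc`.
  set z : ℤ := s - 2 * e + 2 with hz
  push_cast at hs
  have hzc : 2 * z = ((k + 1 : ℕ) : ℤ) * ((d : ℤ) - 1) + 1 := by
    rw [hd', hz]; push_cast; linarith
  have hanti := antitone_boxCount (d := d) (k := k + 1) (z := z) (by linarith)
  set ρ : ℕ → ℤ := fun x => boxCount d (k + 1) (z + x) with hρ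
  have inner : ∀ a ∈ Finset.range e, ∑ b ∈ Finset.Ico a d,
      (boxCount d (k + 1) (s - (a + b : ℕ)) - boxCount d (k + 1) (s - 1 - (a + b : ℕ))) =
      ρ (2 * (e - 1 - a)) - ρ (a + 1) := by
    intro a ha
    have := Finset.mem_range.mp ha
    rw [show ρ (2 * (e - 1 - a)) = boxCount d (k + 1) (s - a - a) by
        simp only [hρ]
        congr 1
        rw [Nat.sub_sub]
        push_cast
        rw [Nat.cast_sub (by omega)]
        push_cast
        linarith,
      show ρ (a + 1) = boxCount d (k + 1) (s - a - d) by
        refine boxCount_symm d (k + 1) _ _ ?_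
        push_cast at hzc ⊢
        linarith,
      ← sum_Ico_boxCount_sub d (k + 1) _ (by omega)]
    refine Finset.sum_congr rfl fun b _ => ?_
    push_cast
    congr 2 <;> ring
  rw [Finset.sum_congr rfl inner, Finset.sum_sub_distrib,
    Finset.sum_range_reflect (fun j => ρ (2 * j))]
  -- With one variable fewer, the doubled distances to the centre of z + e + 1 - d and z + 1 - d are
  -- 2 and 2e - 2, so strictness again uses e ≥ 3.
  have hgap : ρ 0 - ρ 1 < ρ e - ρ (e + 1) := by
    have h0 := boxCount_succ_add_one_sub d k z
    have h1 := boxCount_succ_add_one_sub d k (z + e)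
    have hzk : 2 * z - k * ((d : ℤ) - 1) = 2 * e := by
      rw [hzc]; push_cast; rw [hd']; ring
    have h2 : boxCount d k (z + 1 - d) < boxCount d k (z + e + 1 - d) := by
      refine boxCount_lt (by omega) (by omega) ?_ ?_
      · rw [show 2 * (z + e + 1 - d) - k * ((d : ℤ) - 1) = 2 by linarith,
          show 2 * (z + 1 - d) - k * ((d : ℤ) - 1) = -(2 * e - 2) by linarith, abs_neg,
          abs_of_nonneg (by linarith : (0 : ℤ) ≤ 2 * e - 2)]
        simp; linarith
      · rw [show 2 * (z + e + 1 - d) - k * ((d : ℤ) - 1) = 2 by linarith, hd', abs_two]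
        nlinarith
    have h3 : boxCount d k (z + e + 1) ≤ boxCount d k (z + 1) := by
      refine boxCount_le ?_
      rw [abs_of_nonneg (by linarith), abs_of_nonneg (by linarith)]
      linarith
    simp only [hρ]
    push_cast
    rw [add_zero, ← add_assoc]
    linarith
  have := sum_lt_sum_of_antitone_even hanti he hgap
  linarith

/-! ### Dimension drop for cubes and fourth powers -/

theorem monomial_appendExp {K : Type*} [Field K] {p k : ℕ} (x : Fin p → ℕ) :
    monomial (appendExp x (0 : Fin k → ℕ)) (1 : K) = ∏ j, X (Fin.castAdd k j) ^ x j := by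
  rw [monomial_eq, C_1, one_mul, Finsupp.prod_fintype _ _ (by simp), Fin.prod_univ_add]
  simp [appendExp]

/-- Sorted exponent vectors with entries less than `d` and some entry less than `e`. -/
def sortedCore (p d e : ℕ) : Finset (Fin p → ℕ) :=
  (Fintype.piFinset fun _ => Finset.range d).filter fun μ =>
    (∀ i j, i ≤ j → μ i ≤ μ j) ∧ ∃ j, μ j < e

theorem mem_sortedCore {p d e : ℕ} (μ : Fin p → ℕ) :
    μ ∈ sortedCore p d e ↔ Monotone μ ∧ (∀ j, μ j < d) ∧ ∃ j, μ j < e := by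
  simp only [sortedCore, Finset.mem_filter, Fintype.mem_piFinset, Finset.mem_range, Monotone]
  tauto

/-- Only the degrees of the core classes matter, so for fixed small parameters the sum is over an
explicit list. -/
theorem sum_sortedCore {p d e : ℕ} {l : List ℕ}
    (h : (sortedCore p d e).val.map (fun μ => ∑ j, μ j) = l) (f : ℕ → ℤ) :
    ∑ μ ∈ sortedCore p d e, f (∑ j, μ j) = (l.map f).sum := by
  rw [← Multiset.sum_coe, ← Multiset.map_coe, ← h, Multiset.map_map]
  rfl

theorem map_sum_sortedCore_three :
    (sortedCore 3 3 1).val.map (fun μ => ∑ j, μ j) = ([0, 1, 2, 2, 3, 4] : List ℕ) := by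
  decide +kernel

theorem map_sum_sortedCore_four :
    (sortedCore 4 4 1).val.map (fun μ => ∑ j, μ j) =
      ([0, 1, 2, 2, 3, 3, 3, 4, 4, 4, 5, 5, 5, 6, 6, 6, 7, 7, 8, 9] : List ℕ) := by
  decide +kernel

/-- The count behind non-injectivity for cubes. -/
theorem sum_sortedCore_three_lt {r k : ℕ} (hk : k = 2 * r) :
    ∑ μ ∈ sortedCore 3 3 1, boxCount 3 k (((k + 2 : ℕ) : ℤ) + 1 - (∑ j, μ j : ℕ)) <
      ∑ μ ∈ sortedCore 3 3 1, boxCount 3 k (((k + 2 : ℕ) : ℤ) - (∑ j, μ j : ℕ)) := by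
  rw [sum_sortedCore map_sum_sortedCore_three
      (fun j => boxCount 3 k (((k + 2 : ℕ) : ℤ) + 1 - (j : ℕ))),
    sum_sortedCore map_sum_sortedCore_three
      (fun j => boxCount 3 k (((k + 2 : ℕ) : ℤ) - (j : ℕ)))]
  have hc : (k : ℤ) * (((3 : ℕ) : ℤ) - 1) = 2 * k := by push_cast; ring
  -- The core degrees 0, …, 4 have multiplicities 1, 1, 2, 1, 1. With P the tail count, the change
  -- in dimension telescopes to P(k+3) + P(k+1) - P(k) - P(k-2); the centre is k.
  have h1 : boxCount 3 k ((k : ℤ) + 3) ≤ boxCount 3 k ((k : ℤ) - 2) := by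
    refine boxCount_le ?_
    rw [hc, show 2 * ((k : ℤ) - 2) - 2 * k = -4 by ring,
      show 2 * ((k : ℤ) + 3) - 2 * k = 6 by ring]
    norm_num
  have h2 : boxCount 3 k ((k : ℤ) + 1) < boxCount 3 k k := by
    rcases Nat.eq_zero_or_pos r with rfl | hr
    · subst hk
      decide
    · refine boxCount_lt (by norm_num) (by omega) ?_ ?_
      · rw [hc, show 2 * ((k : ℤ) + 1) - 2 * k = 2 by ring, sub_self]
        norm_num
      · rw [hc, sub_self, abs_zero]
        positivity
  simp only [List.map_cons, List.map_nil, List.sum_cons, List.sum_nil]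
  push_cast
  ring_nf at h1 h2 ⊢
  linarith

/-- The count behind non-injectivity for fourth powers. -/
theorem sum_sortedCore_four_lt {r k i : ℕ} (hk : k = 2 * r + 1) (hi : i = 3 * r + 6) :
    ∑ μ ∈ sortedCore 4 4 1, boxCount 4 k ((i : ℤ) + 1 - (∑ j, μ j : ℕ)) <
      ∑ μ ∈ sortedCore 4 4 1, boxCount 4 k ((i : ℤ) - (∑ j, μ j : ℕ)) := by
  rw [sum_sortedCore map_sum_sortedCore_four
      (fun j => boxCount 4 k ((i : ℤ) + 1 - (j : ℕ))),
    sum_sortedCore map_sum_sortedCore_four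
      (fun j => boxCount 4 k ((i : ℤ) - (j : ℕ)))]
  have hc : (k : ℤ) * (((4 : ℕ) : ℤ) - 1) = 6 * r + 3 := by rw [hk]; push_cast; ring
  -- Multiplicities 1, 1, 2, 3, 3, 3, 3, 2, 1, 1 leave P(i+1) + P(i-1) + P(i-2) - P(i-6) - P(i-7) -
  -- P(i-9), paired off in `h1`, `h2`, `h3`.
  have h1 : boxCount 4 k ((i : ℤ) + 1) ≤ boxCount 4 k ((i : ℤ) - 9) := by
    refine boxCount_le ?_
    rw [hc, hi]
    push_cast
    rw [show 2 * ((3 * r + 6 : ℤ) - 9) - (6 * r + 3) = -9 by ring,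
      show 2 * ((3 * r + 6 : ℤ) + 1) - (6 * r + 3) = 11 by ring]
    norm_num
  have h2 : boxCount 4 k ((i : ℤ) - 1) < boxCount 4 k ((i : ℤ) - 6) := by
    -- For r = 0 there is a single tail variable, outside the range of `boxCount_lt`.
    rcases Nat.eq_zero_or_pos r with rfl | hr
    · subst hk hi
      decide
    · refine boxCount_lt (by norm_num) (by omega) ?_ ?_
      · rw [hc, hi]
        push_cast
        rw [show 2 * ((3 * r + 6 : ℤ) - 6) - (6 * r + 3) = -3 by ring,
          show 2 * ((3 * r + 6 : ℤ) - 1) - (6 * r + 3) = 7 by ring]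
        norm_num
      · rw [hc, hi]
        push_cast
        rw [show 2 * ((3 * r + 6 : ℤ) - 6) - (6 * r + 3) = -3 by ring, abs_neg]
        simp
  have h3 : boxCount 4 k ((i : ℤ) - 2) ≤ boxCount 4 k ((i : ℤ) - 7) := by
    refine boxCount_le ?_
    rw [hc, hi]
    push_cast
    rw [show 2 * ((3 * r + 6 : ℤ) - 7) - (6 * r + 3) = -5 by ring,
      show 2 * ((3 * r + 6 : ℤ) - 2) - (6 * r + 3) = 5 by ring]
    norm_num
  simp only [List.map_cons, List.map_nil, List.sum_cons, List.sum_nil]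
  push_cast
  ring_nf at h1 h2 h3 ⊢
  linarith

/-! ### Kernel elements for a generator in two variables -/

/-- Non-injectivity for `(x_1^d, …, x_n^d, x_1^(e+1) x_2^e)` with `d = 2e + 1`. -/
theorem exists_mul_mem_odd {K : Type*} [Field K] {e k i : ℕ} (he : 2 ≤ e) (hk : 3 ≤ k)
    (hi : i + 1 = (k + 2) * e) (c : Fin (2 + k) → K) (hc : ∀ j, c j ≠ 0) :
    ∃ f : MvPolynomial (Fin (2 + k)) K, f.IsHomogeneous i ∧
      f ∉ powersAnd (2 * e + 1) (monomial (appendExp ![e + 1, e] 0) (1 : K)) ∧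
      linearForm c * f ∈ powersAnd (2 * e + 1) (monomial (appendExp ![e + 1, e] 0) (1 : K)) := by
  refine exists_mul_mem_of_boxCount_lt (T := Σ _ : ℕ, ℕ) (fun x => ⟨x 0, x 1⟩)
    (fun x => (x 0 < 2 * e + 1 ∧ x 1 < 2 * e + 1) ∧ ¬ (e + 1 ≤ x 0 ∧ e ≤ x 1))
    (fun μ => μ.1 + μ.2)
    ((Finset.range (2 * e + 1)).sigma
        (fun a => Finset.Ico 0 (if a ≤ e then 2 * e + 1 else e))) ?_ ?_ ?_ ?_ ?_ ?_ c hc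
  · intro x y h
    -- The generator is not symmetric, so the classes remember both core exponents and only the
    -- identity permutation occurs.
    refine ⟨1, ?_, fun z => rfl⟩
    simp only [Sigma.mk.injEq, heq_eq_eq] at h
    ext j
    fin_cases j
    · exact h.1.symm
    · exact h.2.symm
  · intro x y h
    simp only [Sigma.mk.injEq, heq_eq_eq] at h
    simp only [h.1, h.2]
    exact id
  · intro x
    simp
  · intro a
    rw [IsStandard, Fin.forall_fin_add, Fin.forall_fin_two]
    have : appendExp ![e + 1, e] (0 : Fin k → ℕ) ≤ a ↔ e + 1 ≤ coreExp a 0 ∧ e ≤ coreExp a 1 := by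
      rw [← Finsupp.coe_le_coe, Pi.le_def, Fin.forall_fin_add, Fin.forall_fin_two]
      simp [appendExp, coreExp]
    rw [this]
    simp only [coreExp, tailExp]
    tauto
  · rintro ⟨a, b⟩
    simp only [Finset.mem_sigma, Finset.mem_range, Finset.mem_Ico, Sigma.mk.injEq, heq_eq_eq]
    constructor
    · rintro ⟨h1, -, h2⟩
      refine ⟨![a, b], ?_, by simp⟩
      simp only [Matrix.cons_val_zero, Matrix.cons_val_one]
      split_ifs at h2 <;> omega
    · rintro ⟨x, h, rfl, rfl⟩
      split_ifs <;> omega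
  · have h := sum_boxCount_lt_odd he hk (i + 1) (by exact_mod_cast hi)
    rwa [add_sub_cancel_right] at h

theorem sum_sortedCore_two (e : ℕ) (f : ℕ → ℤ) :
    ∑ μ ∈ sortedCore 2 (2 * e) e, f (∑ j, μ j) =
      ∑ μ ∈ (Finset.range e).sigma (fun a => Finset.Ico a (2 * e)), f (μ.1 + μ.2) := by
  refine Finset.sum_nbij' (fun x => ⟨x 0, x 1⟩) (fun μ => ![μ.1, μ.2]) ?_ ?_ ?_ ?_ ?_
  · intro x hx
    rw [mem_sortedCore] at hx
    obtain ⟨h1, h2, j, h3⟩ := hx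
    have h4 : x 0 ≤ x 1 := h1 (by decide)
    have h5 : x 0 ≤ x j := h1 (Fin.zero_le j)
    simp only [Finset.mem_sigma, Finset.mem_range, Finset.mem_Ico]
    exact ⟨by omega, h4, h2 1⟩
  · rintro ⟨a, b⟩ h
    simp only [Finset.mem_sigma, Finset.mem_range, Finset.mem_Ico] at h
    rw [mem_sortedCore, Fin.monotone_iff_le_succ, Fin.forall_fin_two]
    refine ⟨by simpa using h.2.1, ⟨?_, by simpa using h.2.2⟩, 0, by simpa using h.1⟩
    simp only [Matrix.cons_val_zero]
    omega
  · intro x _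
    ext j
    fin_cases j <;> rfl
  · intro μ _
    rfl
  · intro x _
    simp

/-- Non-injectivity for `(x_1^d, …, x_n^d, x_1^e x_2^e)` with `d = 2e`. -/
theorem exists_mul_mem_even {K : Type*} [Field K] {e k i : ℕ} (he : 3 ≤ e) (hk : 3 ≤ k)
    (hi : 2 * (i + 1) + 1 = (k + 2) * (2 * e - 1)) (c : Fin (2 + k) → K) (hc : ∀ j, c j ≠ 0) :
    ∃ f : MvPolynomial (Fin (2 + k)) K, f.IsHomogeneous i ∧
      f ∉ powersAnd (2 * e) (monomial (appendExp (fun _ => e) 0) (1 : K)) ∧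
      linearForm c * f ∈ powersAnd (2 * e) (monomial (appendExp (fun _ => e) 0) (1 : K)) := by
  refine exists_mul_mem_of_sorted_boxCount_lt rfl _ mem_sortedCore ?_ c hc
  rw [sum_sortedCore_two e (fun j => boxCount (2 * e) k ((i : ℤ) + 1 - j)),
    sum_sortedCore_two e (fun j => boxCount (2 * e) k ((i : ℤ) - j))]
  have h := sum_boxCount_lt_even he hk (i + 1) (by
    zify at hi
    rw [Nat.cast_sub (by omega)] at hi
    push_cast at hi
    exact hi)
  rwa [add_sub_cancel_right] at h

/-! ### Apolarity and cokernel obstructions -/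

/-- The derivation `∑ ∂/∂x_i`. -/
noncomputable def sumDeriv (K : Type*) [Field K] (n : ℕ) :
    Derivation K (MvPolynomial (Fin n) K) (MvPolynomial (Fin n) K) :=
  mkDerivation K fun _ => 1

theorem sumDeriv_eq_sum {K : Type*} [Field K] {n : ℕ} (F : MvPolynomial (Fin n) K) :
    sumDeriv K n F = ∑ i, pderiv i F := by
  have hcoe : ⇑(∑ i, pderiv i : Derivation K (MvPolynomial (Fin n) K) _) = ∑ i, ⇑(pderiv i) :=
    map_sum Derivation.coeFnAddMonoidHom _ _
  have : sumDeriv K n = ∑ i, pderiv i := by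
    refine derivation_ext fun j => ?_
    simp [hcoe, sumDeriv, pderiv_X, Pi.single_apply]
  rw [this, hcoe, Finset.sum_apply]

theorem sumDeriv_X {K : Type*} [Field K] {n : ℕ} (i : Fin n) : sumDeriv K n (X i) = 1 :=
  mkDerivation_X _ _ _

theorem sumDeriv_X_sub_X {K : Type*} [Field K] {n : ℕ} (i j : Fin n) :
    sumDeriv K n (X i - X j) = 0 := by
  rw [map_sub, sumDeriv_X, sumDeriv_X, sub_self]

theorem sumDeriv_mul_eq_zero {K : Type*} [Field K] {n : ℕ} {F G : MvPolynomial (Fin n) K}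
    (hF : sumDeriv K n F = 0) (hG : sumDeriv K n G = 0) : sumDeriv K n (F * G) = 0 := by
  simp [Derivation.leibniz, hF, hG]

theorem sumDeriv_pow_eq_zero {K : Type*} [Field K] {n : ℕ} {F : MvPolynomial (Fin n) K}
    (hF : sumDeriv K n F = 0) (m : ℕ) : sumDeriv K n (F ^ m) = 0 := by
  simp [Derivation.leibniz_pow, hF]

/-- The functional on polynomials obtained by pairing with `F` under the differentiation pairing,
twisted by the weights `c`. -/
noncomputable def apolarFunctional {K : Type*} [Field K] {n : ℕ} (c : Fin n → K)
    (F : MvPolynomial (Fin n) K) : MvPolynomial (Fin n) K →ₗ[K] K :=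
  (basisMonomials (Fin n) K).constr K fun a =>
    (∏ j, (((a j).factorial : K) * (c j ^ a j)⁻¹)) * coeff a F

theorem apolarFunctional_monomial {K : Type*} [Field K] {n : ℕ} (c : Fin n → K)
    (F : MvPolynomial (Fin n) K) (a : Fin n →₀ ℕ) :
    apolarFunctional c F (monomial a 1) =
      (∏ j, (((a j).factorial : K) * (c j ^ a j)⁻¹)) * coeff a F := by
  have := (basisMonomials (Fin n) K).constr_basis K (fun a =>
    (∏ j, (((a j).factorial : K) * (c j ^ a j)⁻¹)) * coeff a F) a
  rwa [coe_basisMonomials] at this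

theorem apolarFunctional_eq_zero {K : Type*} [Field K] {n : ℕ} (c : Fin n → K)
    {F p : MvPolynomial (Fin n) K} (h : ∀ a ∈ p.support, coeff a F = 0) :
    apolarFunctional c F p = 0 := by
  rw [p.as_sum, map_sum]
  refine Finset.sum_eq_zero fun a ha => ?_
  rw [← mul_one (coeff a p), ← smul_eq_mul, ← smul_monomial, map_smul,
    apolarFunctional_monomial, h a ha, mul_zero, smul_zero]

theorem apolarFunctional_linearForm_mul {K : Type*} [Field K] {n : ℕ} (c : Fin n → K)
    (hc : ∀ j, c j ≠ 0) {F : MvPolynomial (Fin n) K} (hF : sumDeriv K n F = 0)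
    (p : MvPolynomial (Fin n) K) : apolarFunctional c F (linearForm c * p) = 0 := by
  have h : apolarFunctional c F ∘ₗ LinearMap.mulLeft K (linearForm c) = 0 := by
    refine (basisMonomials (Fin n) K).ext fun b => ?_
    rw [coe_basisMonomials, LinearMap.comp_apply, LinearMap.mulLeft_apply, LinearMap.zero_apply,
      linearForm, Finset.sum_mul, map_sum]
    -- The factor b_i + 1 from (b_i + 1)! is the one produced by ∂/∂x_i, and c_i cancels one power
    -- of its inverse weight. Summing over i gives a coefficient of ∑ ∂F/∂x_i.
    have hterm : ∀ i, apolarFunctional c F (C (c i) * X i * monomial b 1) =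
        (∏ j, (((b j).factorial : K) * (c j ^ b j)⁻¹)) * coeff b (pderiv i F) := by
      intro i
      rw [mul_assoc, ← smul_eq_C_mul, map_smul, mul_comm (X i), X, monomial_mul, mul_one,
        apolarFunctional_monomial, coeff_pderiv,
        ← Finset.mul_prod_erase _ _ (Finset.mem_univ i),
        ← Finset.mul_prod_erase _ (fun j => (((b j).factorial : K) * (c j ^ b j)⁻¹))
          (Finset.mem_univ i)]
      have : ∏ j ∈ Finset.univ.erase i, (((((b + Finsupp.single i 1 : Fin n →₀ ℕ) j).factorial : K) *
          (c j ^ (b + Finsupp.single i 1 : Fin n →₀ ℕ) j)⁻¹)) =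
          ∏ j ∈ Finset.univ.erase i, (((b j).factorial : K) * (c j ^ b j)⁻¹) := by
        refine Finset.prod_congr rfl fun j hj => ?_
        rw [Finsupp.add_apply, Finsupp.single_eq_of_ne (Finset.ne_of_mem_erase hj), add_zero]
      rw [this, Finsupp.add_apply, Finsupp.single_eq_same, Nat.factorial_succ, pow_succ, smul_eq_mul]
      have h1 := hc i
      have h2 : c i ^ b i ≠ 0 := pow_ne_zero _ h1
      push_cast
      field_simp
    rw [Finset.sum_congr rfl fun i _ => hterm i, ← Finset.mul_sum, ← coeff_sum,
      ← sumDeriv_eq_sum, hF, coeff_zero, mul_zero]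
  exact LinearMap.congr_fun h p

/-- `F` is a nonzero form of degree `t` in the variables indexed by `V`, invariant under
simultaneous translation of the variables, all of whose monomials are outside the ideal
`(x_1^d, …, x_n^d, x^u)`. -/
structure IsDualSocleForm {K : Type*} [Field K] {n : ℕ} (d : ℕ) (u : Fin n →₀ ℕ)
    (V : Set (Fin n)) (t : ℕ) (F : MvPolynomial (Fin n) K) : Prop where
  ne_zero : F ≠ 0
  isHomogeneous : F.IsHomogeneous t
  sumDeriv_eq_zero : sumDeriv K n F = 0
  mem_supported : F ∈ supported K V
  isStandard : ∀ a ∈ F.support, IsStandard d u a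

/-- A translation invariant form with standard monomials obstructs surjectivity. -/
theorem IsDualSocleForm.exists_functional {K : Type*} [Field K] [CharZero K] {n d : ℕ}
    {u : Fin n →₀ ℕ} {V : Set (Fin n)} {t : ℕ} {F : MvPolynomial (Fin n) K}
    (hF : IsDualSocleForm d u V t F) (c : Fin n → K) (hc : ∀ j, c j ≠ 0) :
    ∃ φ : MvPolynomial (Fin n) K →ₗ[K] K,
      (∀ p ∈ powersAnd d (monomial u (1 : K)), φ p = 0) ∧
      (∀ p, φ (linearForm c * p) = 0) ∧
        ∃ p : MvPolynomial (Fin n) K, p.IsHomogeneous t ∧ φ p ≠ 0 := by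
  refine ⟨apolarFunctional c F, fun p hp => ?_,
    apolarFunctional_linearForm_mul c hc hF.sumDeriv_eq_zero, ?_⟩
  · rw [mem_powersAnd_monomial] at hp
    refine apolarFunctional_eq_zero c fun a ha => ?_
    by_contra h
    exact hp a ha (hF.isStandard a (mem_support_iff.mpr h))
  · obtain ⟨a, ha⟩ := ne_zero_iff.mp hF.ne_zero
    have hdeg : a.degree = t := by
      by_contra h
      exact ha (hF.isHomogeneous.coeff_eq_zero h)
    refine ⟨monomial a 1, isHomogeneous_monomial _ hdeg, ?_⟩
    rw [apolarFunctional_monomial]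
    refine mul_ne_zero (Finset.prod_ne_zero_iff.mpr fun j _ => ?_) ha
    -- The factorial weights are nonzero because the characteristic is zero.
    exact mul_ne_zero (Nat.cast_ne_zero.mpr (Nat.factorial_ne_zero _))
      (inv_ne_zero (pow_ne_zero _ (hc j)))

theorem eq_zero_of_mem_supported {K : Type*} [Field K] {n : ℕ} {V : Set (Fin n)}
    {F : MvPolynomial (Fin n) K} (hF : F ∈ supported K V) {a : Fin n →₀ ℕ}
    (ha : a ∈ F.support) {i : Fin n} (hi : i ∉ V) : a i = 0 := by
  by_contra h
  exact hi (mem_supported.mp hF (mem_vars_iff_mem_support i |>.mpr ⟨a, ha, Finsupp.mem_support_iff.mpr h⟩))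

/-- Multiplication by a translation invariant form in new variables. -/
theorem IsDualSocleForm.mul {K : Type*} [Field K] {n d : ℕ}
    {u : Fin n →₀ ℕ} {V W : Set (Fin n)} {t r : ℕ} {F G : MvPolynomial (Fin n) K}
    (hF : IsDualSocleForm d u V t F) (hu : ∀ i ∉ V, u i = 0)
    (hG0 : G ≠ 0) (hGhom : G.IsHomogeneous r) (hGd : sumDeriv K n G = 0)
    (hG : G ∈ supported K W) (hVW : Disjoint V W)
    (hGdeg : ∀ i, G.degreeOf i < d) :
    IsDualSocleForm d u (V ∪ W) (t + r) (F * G) where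
  ne_zero := mul_ne_zero hF.ne_zero hG0
  isHomogeneous := hF.isHomogeneous.mul hGhom
  sumDeriv_eq_zero := sumDeriv_mul_eq_zero hF.sumDeriv_eq_zero hGd
  mem_supported := Subalgebra.mul_mem _
    (supported_mono Set.subset_union_left hF.mem_supported)
    (supported_mono Set.subset_union_right hG)
  isStandard := by
    classical
    intro a ha
    obtain ⟨b, hb, e, he, rfl⟩ := Finset.mem_add.mp (support_mul F G ha)
    have hstd := hF.isStandard b hb
    have he0 : ∀ i ∈ V, e i = 0 := fun i hi =>
      eq_zero_of_mem_supported hG he (Set.disjoint_left.mp hVW hi)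
    have hb0 : ∀ i ∉ V, b i = 0 := fun i hi => eq_zero_of_mem_supported hF.mem_supported hb hi
    refine ⟨fun i => ?_, fun h => hstd.2 fun i => ?_⟩
    · by_cases hi : i ∈ V
      · simpa [he0 i hi] using hstd.1 i
      · rw [Finsupp.add_apply, hb0 i hi, zero_add]
        exact (monomial_le_degreeOf i he).trans_lt (hGdeg i)
    · by_cases hi : i ∈ V
      · simpa [he0 i hi] using h i
      · rw [hu i hi]
        exact Nat.zero_le _

/-! ### Construction of translation invariant forms -/

theorem X_sub_X_ne_zero {K : Type*} [Field K] {n : ℕ} {i j : Fin n} (h : i ≠ j) :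
    (X i - X j : MvPolynomial (Fin n) K) ≠ 0 :=
  sub_ne_zero.mpr fun h' => h (X_injective h')

theorem X_sub_X_isHomogeneous {K : Type*} [Field K] {n : ℕ} (i j : Fin n) :
    (X i - X j : MvPolynomial (Fin n) K).IsHomogeneous 1 :=
  (isHomogeneous_X K i).sub (isHomogeneous_X K j)

theorem X_sub_X_mem_supported {K : Type*} [Field K] {n : ℕ} {V : Set (Fin n)} {i j : Fin n}
    (hi : i ∈ V) (hj : j ∈ V) : (X i - X j : MvPolynomial (Fin n) K) ∈ supported K V :=
  Subalgebra.sub_mem _ (X_mem_supported.mpr hi) (X_mem_supported.mpr hj)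

theorem degreeOf_X_sub_X_le {K : Type*} [Field K] {n : ℕ} (l i j : Fin n) :
    (X i - X j : MvPolynomial (Fin n) K).degreeOf l ≤ if l = i ∨ l = j then 1 else 0 := by
  classical
  refine (degreeOf_sub_le l _ _).trans ?_
  rw [degreeOf_X, degreeOf_X]
  split_ifs <;> simp_all

theorem degreeOf_X_sub_X_pow_le {K : Type*} [Field K] {n : ℕ} (l i j : Fin n) (m : ℕ) :
    ((X i - X j : MvPolynomial (Fin n) K) ^ m).degreeOf l ≤ if l = i ∨ l = j then m else 0 := by
  refine (degreeOf_pow_le l _ m).trans ((Nat.mul_le_mul_left m (degreeOf_X_sub_X_le l i j)).trans ?_)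
  split_ifs <;> simp

/-- Extension of a form in the first `q` variables to all variables, two at a time. -/
theorem IsDualSocleForm.exists_extension {K : Type*} [Field K] {n d : ℕ} (hd : 1 ≤ d)
    {u : Fin n →₀ ℕ} {q t : ℕ} {F : MvPolynomial (Fin n) K}
    (hF : IsDualSocleForm d u {i | i.val < q} t F) (hu : ∀ i : Fin n, q ≤ i.val → u i = 0)
    {r : ℕ} (hr : n = q + 2 * r) :
    ∃ (V : Set (Fin n)) (F' : MvPolynomial (Fin n) K),
      IsDualSocleForm d u V (t + r * (d - 1)) F' := by
  induction r generalizing q t F with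
  | zero => exact ⟨_, F, by simpa using hF⟩
  | succ r ih =>
    let i : Fin n := ⟨q, by omega⟩
    let j : Fin n := ⟨q + 1, by omega⟩
    have hij : i ≠ j := by simp [i, j]
    have h := hF.mul (W := {i, j}) (G := (X i - X j) ^ (d - 1)) (r := d - 1)
      (fun l hl => hu l (by simpa using hl)) (pow_ne_zero _ (X_sub_X_ne_zero hij))
      (by simpa using (X_sub_X_isHomogeneous i j).pow (d - 1))
      (sumDeriv_pow_eq_zero (sumDeriv_X_sub_X i j) _)
      (Subalgebra.pow_mem _ (X_sub_X_mem_supported (by simp) (by simp)) _)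
      (by rw [Set.disjoint_left]; rintro l hl (rfl | rfl) <;> simp [i, j] at hl)
      (fun l => (degreeOf_X_sub_X_pow_le l i j (d - 1)).trans_lt (by split_ifs <;> omega))
    have hV : ({l : Fin n | l.val < q} ∪ {i, j} : Set (Fin n)) = {l | l.val < q + 2} := by
      ext l
      simp only [Set.mem_union, Set.mem_ofPred_eq, Set.mem_insert_iff, Set.mem_singleton_iff,
        Fin.ext_iff, i, j]
      omega
    rw [hV] at h
    obtain ⟨V, F', hF'⟩ := ih h (fun l hl => hu l (by omega)) (by omega)
    refine ⟨V, F', ?_⟩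
    have : t + (r + 1) * (d - 1) = t + (d - 1) + r * (d - 1) := by ring
    rwa [this]

/-- The form `(x_i - x_j)^(d-1)`, when the extra generator has degree at least `d`. -/
theorem isDualSocleForm_pow {K : Type*} [Field K] {n d : ℕ} {u : Fin n →₀ ℕ} (hd : 1 ≤ d)
    (hu : d ≤ u.degree) {i j : Fin n} (hij : i ≠ j) :
    IsDualSocleForm d u {i, j} (d - 1) ((X i - X j : MvPolynomial (Fin n) K) ^ (d - 1)) where
  ne_zero := pow_ne_zero _ (X_sub_X_ne_zero hij)
  isHomogeneous := by simpa using (X_sub_X_isHomogeneous i j).pow (d - 1)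
  sumDeriv_eq_zero := sumDeriv_pow_eq_zero (sumDeriv_X_sub_X i j) _
  mem_supported := Subalgebra.pow_mem _ (X_sub_X_mem_supported (by simp) (by simp)) _
  isStandard := by
    intro a ha
    refine ⟨fun l => (monomial_le_degreeOf l ha).trans_lt
      ((degreeOf_X_sub_X_pow_le l i j (d - 1)).trans_lt (by split_ifs <;> omega)), fun h => ?_⟩
    have h1 : a.degree = d - 1 := by
      by_contra hne
      refine mem_support_iff.mp ha ?_
      have := (X_sub_X_isHomogeneous (K := K) i j).pow (d - 1)
      rw [one_mul] at this
      exact this.coeff_eq_zero hne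
    have h2 : u.degree ≤ a.degree := Finsupp.degree_mono h
    omega

/-- A translation invariant form in three variables of the largest possible degree. -/
theorem triangle_properties {K : Type*} [Field K] {n h r : ℕ} (hhr : h ≤ r) {a b c : Fin n}
    (hab : a ≠ b) (hac : a ≠ c) (hbc : b ≠ c) :
    let G : MvPolynomial (Fin n) K := (X a - X b) ^ h * (X a - X c) ^ h * (X b - X c) ^ r
    G ≠ 0 ∧ G.IsHomogeneous (h + h + r) ∧ sumDeriv K n G = 0 ∧ G ∈ supported K {a, b, c} ∧
      ∀ l, G.degreeOf l ≤ h + r := by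
  refine ⟨?_, ?_, ?_, ?_, fun l => ?_⟩
  · exact mul_ne_zero (mul_ne_zero (pow_ne_zero _ (X_sub_X_ne_zero hab))
      (pow_ne_zero _ (X_sub_X_ne_zero hac))) (pow_ne_zero _ (X_sub_X_ne_zero hbc))
  · simpa using (((X_sub_X_isHomogeneous a b).pow h).mul
      ((X_sub_X_isHomogeneous a c).pow h)).mul ((X_sub_X_isHomogeneous (K := K) b c).pow r)
  · exact sumDeriv_mul_eq_zero (sumDeriv_mul_eq_zero
      (sumDeriv_pow_eq_zero (sumDeriv_X_sub_X a b) _)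
      (sumDeriv_pow_eq_zero (sumDeriv_X_sub_X a c) _))
      (sumDeriv_pow_eq_zero (sumDeriv_X_sub_X b c) _)
  · exact Subalgebra.mul_mem _ (Subalgebra.mul_mem _
      (Subalgebra.pow_mem _ (X_sub_X_mem_supported (by simp) (by simp)) _)
      (Subalgebra.pow_mem _ (X_sub_X_mem_supported (by simp) (by simp)) _))
      (Subalgebra.pow_mem _ (X_sub_X_mem_supported (by simp) (by simp)) _)
  · refine (degreeOf_mul_le _ _ _).trans ((add_le_add ((degreeOf_mul_le _ _ _).trans
      (add_le_add (degreeOf_X_sub_X_pow_le l a b h) (degreeOf_X_sub_X_pow_le l a c h)))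
      (degreeOf_X_sub_X_pow_le l b c r)).trans ?_)
    by_cases h1 : l = a
    · subst h1; simp [hab, hac, hhr]
    · by_cases h2 : l = b
      · subst h2; simp [h1, hbc]
      · by_cases h3 : l = c
        · subst h3; simp [h1, h2]
        · simp [h1, h2, h3]

/-- The variables split into the pair carrying u, one triangle, and r further pairs. Pairs
contribute d - 1 each, and the triangle ⌊3(d-1)/2⌋, absorbing the odd number of variables. -/
theorem exists_isDualSocleForm_of_degree_le {K : Type*} [Field K] {n d r : ℕ} {u : Fin n →₀ ℕ}
    (hd : 1 ≤ d) (hu : d ≤ u.degree) (hu2 : ∀ i : Fin n, 2 ≤ i.val → u i = 0)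
    (hr : n = 5 + 2 * r) :
    ∃ (V : Set (Fin n)) (F : MvPolynomial (Fin n) K),
      IsDualSocleForm d u V ((n * (d - 1)) / 2) F := by
  let x : Fin 5 → Fin n := fun i => ⟨i, by omega⟩
  have hx : ∀ i j, i ≠ j → x i ≠ x j := fun i j h h' => h (Fin.ext (by simpa [x] using h'))
  have h1 := isDualSocleForm_pow (K := K) (u := u) hd hu (hx 0 1 (by decide))
  -- The exponents h, h, r are the floor, floor and ceiling of (d-1)/2, so h + r = d - 1 keeps each
  -- variable below the d-th power.
  obtain ⟨g1, g2, g3, g4, g5⟩ := triangle_properties (K := K) (h := (d - 1) / 2)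
    (r := d - 1 - (d - 1) / 2) (by omega) (hx 2 3 (by decide)) (hx 2 4 (by decide))
    (hx 3 4 (by decide))
  have hV : ({x 0, x 1} : Set (Fin n)) = {i | i.val < 2} := by
    ext i
    simp only [Set.mem_insert_iff, Set.mem_singleton_iff, Set.mem_ofPred_eq, Fin.ext_iff, x,
      Fin.val_zero, Fin.val_one]
    omega
  rw [hV] at h1
  have h2 := h1.mul (fun i hi => hu2 i (not_lt.mp hi)) g1 g2 g3 g4 (by
    rw [Set.disjoint_left]
    rintro l hl (rfl | rfl | rfl) <;> simp [x] at hl) (fun l => (g5 l).trans_lt (by omega))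
  have hW : ({i : Fin n | i.val < 2} ∪ {x 2, x 3, x 4} : Set (Fin n)) = {i | i.val < 5} := by
    ext i
    simp only [Set.mem_union, Set.mem_insert_iff, Set.mem_singleton_iff, Set.mem_ofPred_eq,
      Fin.ext_iff, x]
    simp only [Fin.coe_ofNat_eq_mod, Nat.reduceMod]
    omega
  rw [hW] at h2
  obtain ⟨V, F, hF⟩ := h2.exists_extension hd (fun i hi => hu2 i (by omega)) hr
  refine ⟨V, F, ?_⟩
  convert hF using 1
  subst hr
  have : (5 + 2 * r) * (d - 1) = 5 * (d - 1) + 2 * (r * (d - 1)) := by ring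
  rw [this]
  omega

theorem not_le_of_mem_supported {K : Type*} [Field K] {n : ℕ} {V : Set (Fin n)}
    {p : MvPolynomial (Fin n) K} (hp : p ∈ supported K V) {u : Fin n →₀ ℕ} {i : Fin n}
    (hi : i ∉ V) (hu : u i ≠ 0) : p ∈ restrictSupport K {a | ¬ u ≤ a} := by
  rw [mem_restrictSupport_iff]
  intro a ha h
  have h1 := eq_zero_of_mem_supported hp ha hi
  have h2 := h i
  omega

/-- The Vandermonde form, for cubes together with a product of three variables. -/
theorem isDualSocleForm_vandermonde {K : Type*} [Field K] {n : ℕ} {u : Fin n →₀ ℕ}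
    {a b c : Fin n} (hab : a ≠ b) (hac : a ≠ c) (hbc : b ≠ c)
    (ha : u a ≠ 0) (hb : u b ≠ 0) (hc : u c ≠ 0) :
    IsDualSocleForm 3 u {a, b, c} 3
      ((X a - X b : MvPolynomial (Fin n) K) ^ 1 * (X a - X c) ^ 1 * (X b - X c) ^ 1) := by
  obtain ⟨g1, g2, g3, g4, g5⟩ := triangle_properties (K := K) le_rfl (h := 1) hab hac hbc
  refine ⟨g1, g2, g3, g4, fun m hm => ⟨fun l =>
    (monomial_le_degreeOf l hm).trans_lt ((g5 l).trans_lt (by norm_num)), ?_⟩⟩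
  have hterm : ∀ i j : Fin n, (X i * X j * (X i - X j) : MvPolynomial (Fin n) K) ∈
      supported K {i, j} := fun i j =>
    Subalgebra.mul_mem _ (Subalgebra.mul_mem _ (X_mem_supported.mpr (by simp))
      (X_mem_supported.mpr (by simp))) (X_sub_X_mem_supported (by simp) (by simp))
  have hmem : ((X a - X b) ^ 1 * (X a - X c) ^ 1 * (X b - X c) ^ 1 : MvPolynomial (Fin n) K) ∈
      restrictSupport K {m | ¬ u ≤ m} := by
    -- The product abc cancels in the expansion, and each remaining summand omits one of the three
    -- variables.
    rw [show ((X a - X b) ^ 1 * (X a - X c) ^ 1 * (X b - X c) ^ 1 : MvPolynomial (Fin n) K) =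
      X a * X b * (X a - X b) - X a * X c * (X a - X c) + X b * X c * (X b - X c) by ring]
    refine Submodule.add_mem _ (Submodule.sub_mem _ ?_ ?_) ?_
    · exact not_le_of_mem_supported (hterm a b) (i := c) (by simp [hac.symm, hbc.symm]) hc
    · exact not_le_of_mem_supported (hterm a c) (i := b) (by simp [hab.symm, hbc]) hb
    · exact not_le_of_mem_supported (hterm b c) (i := a) (by simp [hab, hac]) ha
  exact (mem_restrictSupport_iff K).mp hmem hm

/-- The translation invariant quadratic form
`(x_0 - x_3)(x_1 - x_4) + (x_1 - x_3)(x_2 - x_4) + (x_2 - x_3)(x_0 - x_4)`. -/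
noncomputable def cyclicQuadric (K : Type*) [Field K] {n : ℕ} (x : Fin 5 → Fin n) :
    MvPolynomial (Fin n) K :=
  (X (x 0) - X (x 3)) * (X (x 1) - X (x 4)) + (X (x 1) - X (x 3)) * (X (x 2) - X (x 4)) +
    (X (x 2) - X (x 3)) * (X (x 0) - X (x 4))

theorem cyclicQuadric_ne_zero {K : Type*} [Field K] [CharZero K] {n : ℕ} {x : Fin 5 → Fin n}
    (hx : Function.Injective x) : cyclicQuadric K x ≠ 0 := by
  intro h
  -- At this point the quadric takes the value 3.
  have h1 := congrArg (eval fun i => if i = x 3 ∨ i = x 4 then (0 : K) else 1) h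
  simp [cyclicQuadric, hx.eq_iff] at h1
  norm_num at h1

theorem degreeOf_cyclicQuadric_le {K : Type*} [Field K] {n : ℕ} {x : Fin 5 → Fin n}
    (hx : Function.Injective x) (l : Fin n) : (cyclicQuadric K x).degreeOf l ≤ 1 := by
  have hprod : ∀ i j k m : Fin 5, i ≠ k → i ≠ m → j ≠ k → j ≠ m →
      degreeOf l ((X (x i) - X (x j)) * (X (x k) - X (x m)) : MvPolynomial (Fin n) K) ≤ 1 := by
    intro i j k m hik him hjk hjm
    refine (degreeOf_mul_le _ _ _).trans
      ((add_le_add (degreeOf_X_sub_X_le l _ _) (degreeOf_X_sub_X_le l _ _)).trans ?_)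
    by_cases h : l = x i ∨ l = x j
    · have h' : ¬ (l = x k ∨ l = x m) := by
        rcases h with rfl | rfl <;> simp [hx.eq_iff, *]
      simp [h, h']
    · rw [if_neg h, zero_add]
      split_ifs <;> simp
  refine (degreeOf_add_le _ _ _).trans (max_le ((degreeOf_add_le _ _ _).trans (max_le ?_ ?_)) ?_)
  all_goals exact hprod _ _ _ _ (by decide) (by decide) (by decide) (by decide)

/-- A translation invariant form of degree seven in five variables, with exponents at most three
and no monomial divisible by `x_0 x_1 x_2`. -/
theorem isDualSocleForm_five {K : Type*} [Field K] [CharZero K] {n : ℕ} {u : Fin n →₀ ℕ}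
    {x : Fin 5 → Fin n} (hx : Function.Injective x)
    (h0 : u (x 0) ≠ 0) (h1 : u (x 1) ≠ 0) (h2 : u (x 2) ≠ 0) :
    IsDualSocleForm 4 u (Set.range x) 7
      ((X (x 0) - X (x 1) : MvPolynomial (Fin n) K) ^ 1 * (X (x 0) - X (x 2)) ^ 1 *
        (X (x 1) - X (x 2)) ^ 1 * (X (x 3) - X (x 4)) ^ 2 * cyclicQuadric K x) := by
  have hne : ∀ i j : Fin 5, i ≠ j → x i ≠ x j := fun i j => hx.ne
  obtain ⟨g1, g2, g3, g4, g5⟩ := triangle_properties (K := K) le_rfl (h := 1)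
    (hne 0 1 (by decide)) (hne 0 2 (by decide)) (hne 1 2 (by decide))
  have hX : ∀ i j : Fin 5, (X (x i) - X (x j) : MvPolynomial (Fin n) K) ∈
      supported K (Set.range x) := fun i j => X_sub_X_mem_supported ⟨i, rfl⟩ ⟨j, rfl⟩
  refine ⟨?_, ?_, ?_, ?_, fun m hm => ⟨fun l =>
    (monomial_le_degreeOf l hm).trans_lt ?_, ?_⟩⟩
  · exact mul_ne_zero (mul_ne_zero g1 (pow_ne_zero _ (X_sub_X_ne_zero (hne 3 4 (by decide)))))
      (cyclicQuadric_ne_zero hx)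
  · have hq : (cyclicQuadric K x).IsHomogeneous 2 :=
      (((X_sub_X_isHomogeneous _ _).mul (X_sub_X_isHomogeneous _ _)).add
        ((X_sub_X_isHomogeneous _ _).mul (X_sub_X_isHomogeneous _ _))).add
        ((X_sub_X_isHomogeneous _ _).mul (X_sub_X_isHomogeneous _ _))
    exact (g2.mul ((X_sub_X_isHomogeneous _ _).pow 2)).mul hq
  · refine sumDeriv_mul_eq_zero (sumDeriv_mul_eq_zero g3
      (sumDeriv_pow_eq_zero (sumDeriv_X_sub_X _ _) _)) ?_
    rw [cyclicQuadric, map_add, map_add,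
      sumDeriv_mul_eq_zero (sumDeriv_X_sub_X _ _) (sumDeriv_X_sub_X _ _),
      sumDeriv_mul_eq_zero (sumDeriv_X_sub_X _ _) (sumDeriv_X_sub_X _ _),
      sumDeriv_mul_eq_zero (sumDeriv_X_sub_X _ _) (sumDeriv_X_sub_X _ _), add_zero, add_zero]
  · refine Subalgebra.mul_mem _ (Subalgebra.mul_mem _ (supported_mono ?_ g4)
      (Subalgebra.pow_mem _ (hX 3 4) _)) ?_
    · rintro l (rfl | rfl | rfl) <;> exact ⟨_, rfl⟩
    · exact Subalgebra.add_mem _ (Subalgebra.add_mem _ (Subalgebra.mul_mem _ (hX _ _) (hX _ _))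
        (Subalgebra.mul_mem _ (hX _ _) (hX _ _))) (Subalgebra.mul_mem _ (hX _ _) (hX _ _))
  · have hq := degreeOf_cyclicQuadric_le (K := K) hx l
    have hp := degreeOf_X_sub_X_pow_le (K := K) l (x 3) (x 4) 2
    refine (degreeOf_mul_le _ _ _).trans_lt ?_
    by_cases h : l = x 3 ∨ l = x 4
    · have ht : ((X (x 0) - X (x 1) : MvPolynomial (Fin n) K) ^ 1 * (X (x 0) - X (x 2)) ^ 1 *
          (X (x 1) - X (x 2)) ^ 1).degreeOf l = 0 := by
        refine Nat.le_zero.mp (degreeOf_le_iff.mpr fun a ha =>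
          (eq_zero_of_mem_supported g4 ha ?_).le)
        rcases h with rfl | rfl <;> simp [hx.eq_iff]
      rw [if_pos h] at hp
      have := degreeOf_mul_le l ((X (x 0) - X (x 1) : MvPolynomial (Fin n) K) ^ 1 *
        (X (x 0) - X (x 2)) ^ 1 * (X (x 1) - X (x 2)) ^ 1) ((X (x 3) - X (x 4)) ^ 2)
      omega
    · rw [if_neg h] at hp
      have := degreeOf_mul_le l ((X (x 0) - X (x 1) : MvPolynomial (Fin n) K) ^ 1 *
        (X (x 0) - X (x 2)) ^ 1 * (X (x 1) - X (x 2)) ^ 1) ((X (x 3) - X (x 4)) ^ 2)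
      have := g5 l
      omega
  -- The quadric equals e₂ - (x_3 + x_4)e₁ + 3x_3x_4, with e₁, e₂ elementary symmetric in x_0, x_1,
  -- x_2. Multiplying the Vandermonde of exponents (2,1,0) by e₁ or e₂ gives the alternants (3,1,0)
  -- or (3,2,0). The exponent 0 survives, so the form is an alternating sum of terms each missing
  -- one of x_0, x_1, x_2.
  · let T : Fin 5 → Fin 5 → MvPolynomial (Fin n) K := fun i j =>
      X (x i) * X (x j) * (X (x i) - X (x j)) * (X (x 3) - X (x 4)) ^ 2 *
        (X (x i) * X (x j) - (X (x 3) + X (x 4)) * (X (x i) + X (x j)) +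
          (X (x 3) * X (x 4) + X (x 3) * X (x 4) + X (x 3) * X (x 4)))
    have hT : ∀ i j, T i j ∈ supported K {x i, x j, x 3, x 4} := by
      intro i j
      have hi : (X (x i) : MvPolynomial (Fin n) K) ∈ supported K {x i, x j, x 3, x 4} :=
        X_mem_supported.mpr (by simp)
      have hj : (X (x j) : MvPolynomial (Fin n) K) ∈ supported K {x i, x j, x 3, x 4} :=
        X_mem_supported.mpr (by simp)
      have h3 : (X (x 3) : MvPolynomial (Fin n) K) ∈ supported K {x i, x j, x 3, x 4} :=
        X_mem_supported.mpr (by simp)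
      have h4 : (X (x 4) : MvPolynomial (Fin n) K) ∈ supported K {x i, x j, x 3, x 4} :=
        X_mem_supported.mpr (by simp)
      have h34 := Subalgebra.mul_mem _ h3 h4
      exact Subalgebra.mul_mem _ (Subalgebra.mul_mem _ (Subalgebra.mul_mem _
        (Subalgebra.mul_mem _ hi hj) (Subalgebra.sub_mem _ hi hj))
        (Subalgebra.pow_mem _ (Subalgebra.sub_mem _ h3 h4) 2))
        (Subalgebra.add_mem _ (Subalgebra.sub_mem _ (Subalgebra.mul_mem _ hi hj)
          (Subalgebra.mul_mem _ (Subalgebra.add_mem _ h3 h4) (Subalgebra.add_mem _ hi hj)))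
          (Subalgebra.add_mem _ (Subalgebra.add_mem _ h34 h34) h34))
    have hmem : ((X (x 0) - X (x 1)) ^ 1 * (X (x 0) - X (x 2)) ^ 1 *
        (X (x 1) - X (x 2)) ^ 1 * (X (x 3) - X (x 4)) ^ 2 * cyclicQuadric K x :
          MvPolynomial (Fin n) K) ∈ restrictSupport K {m | ¬ u ≤ m} := by
      rw [show ((X (x 0) - X (x 1)) ^ 1 * (X (x 0) - X (x 2)) ^ 1 *
        (X (x 1) - X (x 2)) ^ 1 * (X (x 3) - X (x 4)) ^ 2 * cyclicQuadric K x :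
          MvPolynomial (Fin n) K) = T 0 1 - T 0 2 + T 1 2 by
            simp only [T, cyclicQuadric]; ring]
      refine Submodule.add_mem _ (Submodule.sub_mem _ ?_ ?_) ?_
      · exact not_le_of_mem_supported (hT 0 1) (i := x 2) (by simp [hx.eq_iff]) h2
      · exact not_le_of_mem_supported (hT 0 2) (i := x 1) (by simp [hx.eq_iff]) h1
      · exact not_le_of_mem_supported (hT 1 2) (i := x 0) (by simp [hx.eq_iff]) h0
    exact (mem_restrictSupport_iff K).mp hmem hm

/-! ### Combining the two obstructions -/

theorem appendExp_apply_of_le {p k : ℕ} (x : Fin p → ℕ) (i : Fin (p + k)) (hi : p ≤ i.val) :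
    appendExp x (0 : Fin k → ℕ) i = 0 := by
  induction i using Fin.addCases with
  | left j => simp at hi; omega
  | right j => simp [appendExp]

theorem degree_appendExp_zero {p k : ℕ} (x : Fin p → ℕ) :
    (appendExp x (0 : Fin k → ℕ)).degree = ∑ j, x j := by
  rw [degree_eq_core_add_tail, coreExp_appendExp, tailExp_appendExp]
  simp

/-- A form obstructing surjectivity together with an obstruction to injectivity gives failure of
the WLP. -/
theorem IsDualSocleForm.failsWLPInDegree {K : Type*} [Field K] [CharZero K] {n d i : ℕ}
    {u : Fin n →₀ ℕ} {V : Set (Fin n)} {F : MvPolynomial (Fin n) K}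
    (hF : IsDualSocleForm d u V (i + 1) F)
    (hker : ∀ c : Fin n → K, (∀ j, c j ≠ 0) → ∃ p : MvPolynomial (Fin n) K,
      p.IsHomogeneous i ∧ p ∉ powersAnd d (monomial u (1 : K)) ∧
        linearForm c * p ∈ powersAnd d (monomial u (1 : K))) :
    FailsWLPInDegree (powersAnd d (monomial u (1 : K))) i :=
  failsWLPInDegree_of_obstructions hker fun c hc => hF.exists_functional c hc

theorem failsWLPInDegree_two_variables {K : Type*} [Field K] [CharZero K] {d k r : ℕ}
    (hd : 5 ≤ d) (hk : k = 3 + 2 * r) :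
    FailsWLPInDegree (powersAnd d (monomial
      (appendExp ![(d + 1) / 2, d / 2] (0 : Fin k → ℕ)) (1 : K)))
      (((2 + k) * (d - 1)) / 2 - 1) := by
  obtain ⟨V, F, hF⟩ := exists_isDualSocleForm_of_degree_le (K := K) (n := 2 + k) (d := d) (r := r)
    (u := appendExp ![(d + 1) / 2, d / 2] 0) (by omega)
    (by rw [degree_appendExp_zero, Fin.sum_univ_two]; simp; omega)
    (fun i hi => appendExp_apply_of_le _ i hi) (by omega)
  have hpos : 1 ≤ ((2 + k) * (d - 1)) / 2 := by
    have : 2 * 1 ≤ (2 + k) * (d - 1) := Nat.mul_le_mul (by omega) (by omega)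
    omega
  rw [← Nat.sub_add_cancel hpos] at hF
  refine hF.failsWLPInDegree fun c hc => ?_
  obtain ⟨e, he⟩ := Nat.even_or_odd' d
  rcases he with rfl | rfl
  · have hu : (![(2 * e + 1) / 2, 2 * e / 2] : Fin 2 → ℕ) = fun _ => e := by
      ext j
      fin_cases j <;> (simp; try omega)
    rw [hu]
    refine exists_mul_mem_even (by omega) (by omega) ?_ c hc
    rw [Nat.sub_add_cancel hpos, add_comm k 2]
    -- Both factors are odd, so halving loses exactly the 1 in the hypothesis of
    -- `exists_mul_mem_even`.
    have : (2 + k) * (2 * e - 1) % 2 = 1 := by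
      rw [Nat.mul_mod, show (2 + k) % 2 = 1 by omega, show (2 * e - 1) % 2 = 1 by omega]
    omega
  · have hu : (![(2 * e + 1 + 1) / 2, (2 * e + 1) / 2] : Fin 2 → ℕ) = ![e + 1, e] := by
      ext j
      fin_cases j <;> simp <;> omega
    rw [hu]
    refine exists_mul_mem_odd (by omega) (by omega) ?_ c hc
    rw [Nat.sub_add_cancel hpos, add_comm k 2, Nat.add_sub_cancel,
      show (2 + k) * (2 * e) = 2 * ((2 + k) * e) by ring, Nat.mul_div_cancel_left _ two_pos]

theorem failsWLPInDegree_fourth_powers {K : Type*} [Field K] [CharZero K] {k r : ℕ}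
    (hk : k = 2 * r + 1) :
    FailsWLPInDegree (powersAnd 4 (monomial
      (appendExp (fun _ : Fin 4 => 1) (0 : Fin k → ℕ)) (1 : K))) (3 * r + 6) := by
  let x : Fin 5 → Fin (4 + k) := fun i => ⟨i, by omega⟩
  have hx : Function.Injective x := fun i j h => Fin.ext (by simpa [x] using h)
  have hu : ∀ j : Fin 4, appendExp (fun _ : Fin 4 => 1) (0 : Fin k → ℕ) (Fin.castAdd k j) ≠ 0 :=
    fun j => by simp [appendExp]
  have h := isDualSocleForm_five (K := K) hx (hu 0) (hu 1) (hu 2)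
  have hV : Set.range x = {i | i.val < 5} := by
    ext i
    exact ⟨by rintro ⟨j, rfl⟩; exact j.2, fun hi => ⟨⟨i, hi⟩, rfl⟩⟩
  rw [hV] at h
  obtain ⟨V, F, hF⟩ := h.exists_extension (r := r) (by norm_num)
    (fun i hi => appendExp_apply_of_le _ i (by omega)) (by omega)
  rw [show 7 + r * (4 - 1) = 3 * r + 6 + 1 by omega] at hF
  exact hF.failsWLPInDegree fun c hc => exists_mul_mem_of_sorted_boxCount_lt rfl _ mem_sortedCore
    (sum_sortedCore_four_lt hk rfl) c hc

theorem failsWLPInDegree_cubes {K : Type*} [Field K] [CharZero K] {k r : ℕ} (hk : k = 2 * r) :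
    FailsWLPInDegree (powersAnd 3 (monomial
      (appendExp (fun _ : Fin 3 => 1) (0 : Fin k → ℕ)) (1 : K))) (k + 2) := by
  let x : Fin 3 → Fin (3 + k) := Fin.castAdd k
  have hx : Function.Injective x := Fin.castAdd_injective 3 k
  have hu : ∀ j : Fin 3, appendExp (fun _ : Fin 3 => 1) (0 : Fin k → ℕ) (x j) ≠ 0 :=
    fun j => by simp [appendExp, x]
  have h := isDualSocleForm_vandermonde (K := K) (hx.ne (show (0 : Fin 3) ≠ 1 by decide))
    (hx.ne (show (0 : Fin 3) ≠ 2 by decide)) (hx.ne (show (1 : Fin 3) ≠ 2 by decide))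
    (hu 0) (hu 1) (hu 2)
  have hV : ({x 0, x 1, x 2} : Set (Fin (3 + k))) = {i | i.val < 3} := by
    ext i
    simp only [Set.mem_insert_iff, Set.mem_singleton_iff, Set.mem_ofPred_eq, Fin.ext_iff, x,
      Fin.val_castAdd]
    simp only [Fin.coe_ofNat_eq_mod, Nat.reduceMod]
    omega
  rw [hV] at h
  obtain ⟨V, F, hF⟩ := h.exists_extension (r := r) (by norm_num)
    (fun i hi => appendExp_apply_of_le _ i hi) (by omega)
  rw [show 3 + r * (3 - 1) = k + 2 + 1 by omega] at hF
  exact hF.failsWLPInDegree fun c hc => exists_mul_mem_of_sorted_boxCount_lt rfl _ mem_sortedCore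
    (sum_sortedCore_three_lt hk) c hc

theorem proposition5p9 (K : Type*) [Field K] [CharZero K] (n m : ℕ) (hnm : n = 2 * m + 1) :
    (∀ (d : ℕ) (_ : 5 ≤ d) (hn : 5 ≤ n),
      FailsWLPInDegree
        (powersAnd d
          ((MvPolynomial.X ⟨0, by omega⟩ ^ ((d + 1) / 2) *
            MvPolynomial.X ⟨1, by omega⟩ ^ (d / 2) : MvPolynomial (Fin n) K)))
        ((n * (d - 1)) / 2 - 1)) ∧
    (∀ hn : 5 ≤ n,
      FailsWLPInDegree
        (powersAnd 4
          ((MvPolynomial.X ⟨0, by omega⟩ * MvPolynomial.X ⟨1, by omega⟩ *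
            MvPolynomial.X ⟨2, by omega⟩ * MvPolynomial.X ⟨3, by omega⟩ :
              MvPolynomial (Fin n) K)))
        (3 * m)) ∧
    (∀ hn : 3 ≤ n,
      FailsWLPInDegree
        (powersAnd 3
          ((MvPolynomial.X ⟨0, by omega⟩ * MvPolynomial.X ⟨1, by omega⟩ *
            MvPolynomial.X ⟨2, by omega⟩ : MvPolynomial (Fin n) K)))
        (2 * m)) := by
  refine ⟨fun d hd hn => ?_, fun hn => ?_, fun hn => ?_⟩
  · obtain ⟨k, rfl⟩ := Nat.exists_eq_add_of_le (show 2 ≤ n by omega)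
    -- Since n = 2m + 1, the n - 5 variables outside the core pair and the triangle form m - 2
    -- pairs.
    have h := failsWLPInDegree_two_variables (K := K) (k := k) (r := m - 2) hd (by omega)
    rw [monomial_appendExp, Fin.prod_univ_two] at h
    exact h
  · obtain ⟨k, rfl⟩ := Nat.exists_eq_add_of_le (show 4 ≤ n by omega)
    have h := failsWLPInDegree_fourth_powers (K := K) (k := k) (r := m - 2) (by omega)
    rw [monomial_appendExp, Fin.prod_univ_four, show 3 * (m - 2) + 6 = 3 * m by omega] at h
    simp only [pow_one] at h
    exact h
  · obtain ⟨k, rfl⟩ := Nat.exists_eq_add_of_le hn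
    have h := failsWLPInDegree_cubes (K := K) (k := k) (r := m - 1) (by omega)
    rw [monomial_appendExp, Fin.prod_univ_three, show k + 2 = 2 * m by omega] at h
    simp only [pow_one] at h
    exact h
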